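/- Let $D\subset\mathbb C^n$, $n>1$, be a domain with $C^2$-smooth boundary, let $\xi\in\partial D$ with unit outward normal $\nu_\xi$, and write $(\cdot,\cdot)$ for the Hermitian product. Choose a unitary coordinate system $z=(z_1,\dots,z_n)$, $z_j=x_j+iy_j$, centred at $\xi$, in which the inner normal $-\nu_\xi$ is the unit vector of the positive $x_1$-axis, so that the complex tangent space is $\{z_1=0\}$. Put $\zeta=(y_1,x_2,y_2,\dots,x_n,y_n)$, and let $\psi$ be a $C^2$ function such that $D=\{x_1>\psi(\zeta)\}$ near $\xi$. Set $$d(z)=\min\{x_1,\;x_1-\psi(\zeta)\},$$ and for $\alpha>0$ $$A_\alpha(\xi)=\{z\in D:\ |z-\xi|^2<\alpha\, d(z),\ |y_1|<\alpha x_1\},$$ $$\mathcal A_\alpha(\xi)=\{z\in D:\ |(z-\xi,\nu_\xi)|<(1+\alpha)\,\delta_\xi(z),\ |z-\xi|^2<\alpha\,\delta_\xi(z)\},$$ where $\delta_\xi(z)$ is the minimum of the Euclidean distance from $z$ to $\partial D$ and of the distance $x_1$ from $z$ to the real tangent plane of $\partial D$ at $\xi$, the latter counted negative on the outer side of that plane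 (so that $\mathcal A_\alpha(\xi)\subset\{x_1>0\}$). For $f$ holomorphic in $D$ let $\nabla f(z)\ge 0$ be given by $$(\nabla f(z))^2=d(z)^2\Big|\frac{\partial f}{\partial z_1}(z)\Big|^2+d(z)\sum_{j=2}^n\Big|\frac{\partial f}{\partial z_j}(z)\Big|^2\qquad(z\in A_\alpha(\xi)).$$ Suppose that the holomorphic function $f$ has a limit along the normal at $\xi$, that is, $\lim_{t\to0+}f(\xi-t\nu_\xi)$ exists in $\overline{\mathbb C}=\mathbb C\cup\{\infty\}$. Then $f$ has an admissible limit at $\xi$, that is, there is $L\in\overline{\mathbb C}$ with $f(z)\to L$ as $z\to\xi$, $z\in\mathcal A_\alpha(\xi)$, for every $\alpha>0$, if and only if for every $\alpha>0$ $$\frac{\nabla f(z)}{1+|f(z)|^2}\to0\qquad\text{as } z\to\xi,\ z\in A_\alpha(\xi).$$ -/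

import Mathlib

open Filter Topology

/-- `ρ` is a local `C²` defining function of `D` at `ξ`: near `ξ`, `D` is the set `{ρ < 0}`,
and `dρ(ξ) ≠ 0`. (For `ξ ∈ ∂D` this forces `ρ ξ = 0`.) -/
structure IsC2DefiningFunctionAt {n : ℕ} (D : Set (EuclideanSpace ℂ (Fin n)))
    (ξ : EuclideanSpace ℂ (Fin n)) (ρ : EuclideanSpace ℂ (Fin n) → ℝ) : Prop where
  contDiffAt : ContDiffAt ℝ 2 ρ ξ
  fderiv_ne_zero : fderiv ℝ ρ ξ ≠ 0
  mem_iff : ∀ᶠ z in 𝓝 ξ, (z ∈ D ↔ ρ z < 0)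

/-- `D` has `C²`-smooth boundary. -/
def HasC2Boundary {n : ℕ} (D : Set (EuclideanSpace ℂ (Fin n))) : Prop :=
  ∀ ξ ∈ frontier D, ∃ ρ : EuclideanSpace ℂ (Fin n) → ℝ, IsC2DefiningFunctionAt D ξ ρ

/-- `ν` is the unit outward normal vector to `∂D` at `ξ`: it has norm one and is a positive
multiple of the real gradient of a defining function. -/
def IsUnitOutwardNormal {n : ℕ} (D : Set (EuclideanSpace ℂ (Fin n)))
    (ξ ν : EuclideanSpace ℂ (Fin n)) : Prop :=
  ‖ν‖ = 1 ∧ ∃ ρ : EuclideanSpace ℂ (Fin n) → ℝ, IsC2DefiningFunctionAt D ξ ρ ∧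
    ∃ c : ℝ, 0 < c ∧ ∀ w, fderiv ℝ ρ ξ w = c * (inner ℂ ν w).re

/-- The complex normal coordinate `z₁ = x₁ + i y₁` of `z`: the Hermitian product of `z - ξ` with
the inner normal `-ν` (`inner ℂ` is conjugate-linear in its first argument). -/
noncomputable def normalCoord {n : ℕ} (ξ ν z : EuclideanSpace ℂ (Fin n)) : ℂ :=
  inner ℂ (-ν) (z - ξ)

/-- The linear real tangent space: the real orthogonal complement of the normal `ν`. -/
noncomputable abbrev realTangent {n : ℕ} (ν : EuclideanSpace ℂ (Fin n)) :
    Submodule ℝ (EuclideanSpace ℂ (Fin n)) :=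
  (Submodule.span ℝ {ν})ᗮ

/-- The real tangential component `ζ = (y₁, x₂, y₂, …, xₙ, yₙ)` of `z`: the orthogonal projection
of `z - ξ` to the real tangent space. -/
noncomputable def tangentCoord {n : ℕ} (ξ ν z : EuclideanSpace ℂ (Fin n)) : realTangent ν :=
  (realTangent ν).orthogonalProjectionOnto (z - ξ)

/-- `ψ` is a `C²` function on the real tangent space whose graph is `∂D` near `ξ`, with `D` above
it: near `ξ`, `D = {x₁ > ψ(ζ)}`. -/
structure IsBoundaryGraphAt {n : ℕ} (D : Set (EuclideanSpace ℂ (Fin n)))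
    (ξ ν : EuclideanSpace ℂ (Fin n)) (ψ : realTangent ν → ℝ) : Prop where
  contDiffAt : ContDiffAt ℝ 2 ψ 0
  mem_iff : ∀ᶠ z in 𝓝 ξ, (z ∈ D ↔ ψ (tangentCoord ξ ν z) < (normalCoord ξ ν z).re)

/-- `δ_ξ(z)`: the minimum of the Euclidean distances from `z` to `∂D` and to the real tangent
plane at `ξ`. The latter is `x₁`, counted negative on the outer side of the tangent plane. -/
noncomputable def deltaAt {n : ℕ} (D : Set (EuclideanSpace ℂ (Fin n)))
    (ξ ν z : EuclideanSpace ℂ (Fin n)) : ℝ :=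
  min (Metric.infDist z (frontier D)) (normalCoord ξ ν z).re

/-- The admissible approach domain with vertex `ξ` and aperture `α`, through which admissible
limits are defined. -/
def admissibleDomain {n : ℕ} (D : Set (EuclideanSpace ℂ (Fin n)))
    (ξ ν : EuclideanSpace ℂ (Fin n)) (α : ℝ) : Set (EuclideanSpace ℂ (Fin n)) :=
  {z ∈ D | ‖inner ℂ ν (z - ξ)‖ < (1 + α) * deltaAt D ξ ν z ∧ ‖z - ξ‖ ^ 2 < α * deltaAt D ξ ν z}

/-- `f` has a limit in the Riemann sphere along the normal at `ξ`. -/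
def HasNormalLimit {n : ℕ} (f : EuclideanSpace ℂ (Fin n) → ℂ)
    (ξ ν : EuclideanSpace ℂ (Fin n)) : Prop :=
  ∃ L : OnePoint ℂ, Tendsto (fun t : ℝ => (f (ξ - t • ν) : OnePoint ℂ)) (𝓝[>] 0) (𝓝 L)

/-- `f` has an admissible limit in the Riemann sphere at `ξ`. -/
def HasAdmissibleLimit {n : ℕ} (D : Set (EuclideanSpace ℂ (Fin n)))
    (f : EuclideanSpace ℂ (Fin n) → ℂ) (ξ ν : EuclideanSpace ℂ (Fin n)) : Prop :=
  ∃ L : OnePoint ℂ, ∀ α : ℝ, 0 < α →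
    Tendsto (fun z => (f z : OnePoint ℂ)) (𝓝[admissibleDomain D ξ ν α] ξ) (𝓝 L)

/-- `d(z) = min {x₁, x₁ - ψ(ζ)}`. -/
noncomputable def graphDist {n : ℕ} (ξ ν : EuclideanSpace ℂ (Fin n)) (ψ : realTangent ν → ℝ)
    (z : EuclideanSpace ℂ (Fin n)) : ℝ :=
  min (normalCoord ξ ν z).re ((normalCoord ξ ν z).re - ψ (tangentCoord ξ ν z))

/-- The approach region `A_α(ξ) = {z ∈ D : |z - ξ|² < α d(z), |y₁| < α x₁}`. -/
def approachRegion {n : ℕ} (D : Set (EuclideanSpace ℂ (Fin n)))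
    (ξ ν : EuclideanSpace ℂ (Fin n)) (ψ : realTangent ν → ℝ) (α : ℝ) :
    Set (EuclideanSpace ℂ (Fin n)) :=
  {z ∈ D | ‖z - ξ‖ ^ 2 < α * graphDist ξ ν ψ z ∧
    |(normalCoord ξ ν z).im| < α * (normalCoord ξ ν z).re}

/-- The weighted gradient: the square root of `d² |∂f/∂z_i|² + d ∑_{j ≠ i} |∂f/∂z_j|²`, where
`z_j` are the coordinates in the orthonormal basis `b` and `i` is the index of the complex normal
direction. -/
noncomputable def weightedGradient {n : ℕ} (ξ ν : EuclideanSpace ℂ (Fin n))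
    (ψ : realTangent ν → ℝ) (b : OrthonormalBasis (Fin n) ℂ (EuclideanSpace ℂ (Fin n)))
    (i : Fin n) (f : EuclideanSpace ℂ (Fin n) → ℂ) (z : EuclideanSpace ℂ (Fin n)) : ℝ :=
  Real.sqrt (graphDist ξ ν ψ z ^ 2 * ‖fderiv ℂ f z (b i)‖ ^ 2 +
    graphDist ξ ν ψ z * ∑ j ∈ Finset.univ.erase i, ‖fderiv ℂ f z (b j)‖ ^ 2)

/-- A defining function vanishes at the boundary point. -/
theorem IsC2DefiningFunctionAt.apply_eq_zero {n : ℕ} {D : Set (EuclideanSpace ℂ (Fin n))}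
    {ξ : EuclideanSpace ℂ (Fin n)} {ρ : EuclideanSpace ℂ (Fin n) → ℝ}
    (h : IsC2DefiningFunctionAt D ξ ρ) (hξ : ξ ∈ frontier D) : ρ ξ = 0 := by
  have hc : ContinuousAt ρ ξ := h.contDiffAt.continuousAt
  rcases lt_trichotomy (ρ ξ) 0 with h0 | h0 | h0
  · exfalso
    apply hξ.2
    rw [mem_interior_iff_mem_nhds]
    filter_upwards [h.mem_iff, hc.eventually_lt continuousAt_const h0] with z h1 h2
    exact h1.2 h2
  · exact h0
  · exfalso
    have : ∀ᶠ z in 𝓝 ξ, z ∉ D := by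
      filter_upwards [h.mem_iff, continuousAt_const.eventually_lt hc h0] with z h1 h2 h3
      exact absurd (h1.1 h3) (not_lt.2 h2.le)
    exact (mem_closure_iff_frequently.1 hξ.1) this

/-- Near a boundary point `D` is the domain above the graph of a `C²` function on the tangent
space. -/
theorem IsUnitOutwardNormal.exists_isBoundaryGraphAt {n : ℕ} {D : Set (EuclideanSpace ℂ (Fin n))}
    {ξ ν : EuclideanSpace ℂ (Fin n)} (hξ : ξ ∈ frontier D) (h : IsUnitOutwardNormal D ξ ν) :
    ∃ ψ : realTangent ν → ℝ, IsBoundaryGraphAt D ξ ν ψ := by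
  obtain ⟨hν, ρ, hρ, c, hc, hg⟩ := h
  have hρ0 := hρ.apply_eq_zero hξ
  have hre : ∀ v w : EuclideanSpace ℂ (Fin n), inner ℝ v w = (inner ℂ v w).re := by
    intro v w
    simp [PiLp.inner_apply]
  let G : realTangent ν × ℝ → EuclideanSpace ℂ (Fin n) := fun p => ξ + (p.1 : _) - p.2 • ν
  let G' : realTangent ν × ℝ →L[ℝ] EuclideanSpace ℂ (Fin n) :=
    (realTangent ν).subtypeL ∘L ContinuousLinearMap.fst ℝ _ _ -
      (ContinuousLinearMap.snd ℝ _ _).smulRight ν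
  have hGG : G = fun p => ξ + G' p := by
    funext p
    simp [G, G', add_sub_assoc]
  have hG0 : G 0 = ξ := by simp [G]
  have hGd : HasFDerivAt G G' 0 := by
    rw [hGG]; exact G'.hasFDerivAt.const_add ξ
  have hGc : ContDiffAt ℝ 2 G 0 := by
    rw [hGG]; exact contDiffAt_const.add G'.contDiff.contDiffAt
  have hR : ContDiffAt ℝ 2 (ρ ∘ G) 0 :=
    ContDiffAt.comp 0 (by rw [hG0]; exact hρ.contDiffAt) hGc
  have hRd : fderiv ℝ (ρ ∘ G) 0 = fderiv ℝ ρ ξ ∘L G' := by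
    have : HasFDerivAt ρ (fderiv ℝ ρ ξ) (G 0) := by
      rw [hG0]; exact (hρ.contDiffAt.differentiableAt (by norm_num)).hasFDerivAt
    exact (this.comp 0 hGd).fderiv
  have hRv : ∀ s : ℝ, fderiv ℝ (ρ ∘ G) 0 (0, s) = -c * s := by
    intro s
    rw [hRd]
    have : G' (0, s) = -(s • ν) := by simp [G']
    rw [ContinuousLinearMap.comp_apply, this, map_neg, map_smul, hg, ← hre,
      real_inner_self_eq_norm_sq, hν]
    simp; ring
  have hinv : (fderiv ℝ (ρ ∘ G) 0 ∘L .inr ℝ (realTangent ν) ℝ).IsInvertible := by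
    refine ⟨ContinuousLinearEquiv.unitsEquivAut ℝ (Units.mk0 (-c) (by simpa using hc.ne')), ?_⟩
    ext
    simp [hRv]
  have h20 : (2 : WithTop ℕ∞) ≠ 0 := by norm_num
  have hψ0 : hR.implicitFunction h20 hinv 0 = 0 := hR.implicitFunction_apply_self h20 hinv
  have hψc : ContDiffAt ℝ 2 (hR.implicitFunction h20 hinv) 0 :=
    hR.contDiffAt_implicitFunction h20 hinv
  have hψe : ∀ᶠ x in 𝓝 (0 : realTangent ν), (ρ ∘ G) (x, hR.implicitFunction h20 hinv x) = 0 := by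
    have := hR.eventually_apply_implicitFunction h20 hinv
    simpa [hG0, hρ0] using this
  set ψ := hR.implicitFunction h20 hinv with hψdef
  refine ⟨ψ, hψc, ?_⟩
  have hs := (hR.hasStrictFDerivAt h20).isLittleO.def (half_pos hc)
  have hζ : Tendsto (tangentCoord ξ ν) (𝓝 ξ) (𝓝 0) := by
    have : Continuous (tangentCoord ξ ν) := by unfold tangentCoord; fun_prop
    simpa [tangentCoord] using this.tendsto ξ
  have hx : Tendsto (fun z => (normalCoord ξ ν z).re) (𝓝 ξ) (𝓝 0) := by
    have : Continuous (fun z => (normalCoord ξ ν z).re) := by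
      unfold normalCoord
      exact Complex.continuous_re.comp (by fun_prop)
    simpa [normalCoord] using this.tendsto ξ
  have hψt : Tendsto (fun z => ψ (tangentCoord ξ ν z)) (𝓝 ξ) (𝓝 0) := by
    have : Tendsto ψ (𝓝 0) (𝓝 0) := by simpa [hψ0] using hψc.continuousAt.tendsto
    exact this.comp hζ
  have hpq := (((hζ.prodMk_nhds hx).prodMk_nhds (hζ.prodMk_nhds hψt)).eventually hs)
  filter_upwards [hρ.mem_iff, hpq, hζ.eventually hψe] with z h1 h2 h3
  have hdec : G (tangentCoord ξ ν z, (normalCoord ξ ν z).re) = z := by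
    have e1 : (tangentCoord ξ ν z : EuclideanSpace ℂ (Fin n)) =
        (z - ξ) - (inner ℝ ν (z - ξ)) • ν := by
      simp only [tangentCoord]
      rw [Submodule.coe_orthogonalProjectionOnto_apply,
        Submodule.starProjection_orthogonal_val, Submodule.starProjection_unit_singleton ℝ hν]
    simp only [G, e1, normalCoord, inner_neg_left, Complex.neg_re, ← hre]
    module
  simp only [Function.comp_apply] at h2 h3
  rw [hdec, h3] at h2
  have hsub : ((tangentCoord ξ ν z, (normalCoord ξ ν z).re) : realTangent ν × ℝ) -
      (tangentCoord ξ ν z, ψ (tangentCoord ξ ν z)) =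
      (0, (normalCoord ξ ν z).re - ψ (tangentCoord ξ ν z)) := by simp
  rw [hsub, hRv] at h2
  have hn : ‖((0, (normalCoord ξ ν z).re - ψ (tangentCoord ξ ν z)) : realTangent ν × ℝ)‖ =
      |(normalCoord ξ ν z).re - ψ (tangentCoord ξ ν z)| := by simp [Prod.norm_def]
  rw [hn, Real.norm_eq_abs, abs_le] at h2
  rw [h1]
  set t := (normalCoord ξ ν z).re - ψ (tangentCoord ξ ν z) with ht
  have h4 : ψ (tangentCoord ξ ν z) < (normalCoord ξ ν z).re ↔ 0 < t := sub_pos.symm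
  rw [h4]
  constructor
  · intro hneg
    by_contra hle
    push Not at hle
    rw [abs_of_nonpos hle] at h2
    nlinarith
  · intro hpos
    rw [abs_of_pos hpos] at h2
    nlinarith

/-- A unit outward normal exists at every point of a `C²`-smooth boundary. -/
theorem HasC2Boundary.exists_isUnitOutwardNormal {n : ℕ} {D : Set (EuclideanSpace ℂ (Fin n))}
    (hD : HasC2Boundary D) {ξ : EuclideanSpace ℂ (Fin n)} (hξ : ξ ∈ frontier D) :
    ∃ ν, IsUnitOutwardNormal D ξ ν := by
  obtain ⟨ρ, hρ⟩ := hD ξ hξ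
  have hre : ∀ v w : EuclideanSpace ℂ (Fin n), inner ℝ v w = (inner ℂ v w).re := by
    intro v w
    simp [PiLp.inner_apply]
  set g := (InnerProductSpace.toDual ℝ (EuclideanSpace ℂ (Fin n))).symm (fderiv ℝ ρ ξ) with hg
  have hg0 : g ≠ 0 := by simpa [hg] using hρ.fderiv_ne_zero
  have hgn : 0 < ‖g‖ := norm_pos_iff.2 hg0
  refine ⟨‖g‖⁻¹ • g, by simp [norm_smul, hgn.ne'], ρ, hρ, ‖g‖, hgn, fun w => ?_⟩
  rw [← hre, real_inner_smul_left, ← mul_assoc, mul_inv_cancel₀ hgn.ne', one_mul, hg,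
    InnerProductSpace.toDual_symm_apply]

/-! Up to constants, $\nabla f/(1+|f|^2)$ is the largest spherical speed of $f$ along vectors whose
complex normal component is $O(d)$ and whose length is $O(\sqrt d)$. Both directions rest on this
scaling. Near $\xi$ the regions $\mathcal A_\alpha$ and $A_\alpha$ are cofinal, because $\delta_\xi$
and $d$ are comparable there (`IsBoundaryGraphAt.hasAdmissibleLimit_iff`), so only $A_\alpha$
matters.

If the gradient condition holds, join $z\in A_\alpha$ to the point $\xi-x_1\nu$ of the normal at the
same height. The velocity of this segment has normal component $iy_1=O(x_1)=O(d)$ and length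
$O(|z-\xi|)=O(\sqrt d)$. The segment stays in $A_{2\alpha}$ with $d$ at least half its value at $z$:
by Taylor, $\psi(t\zeta)\le\max(0,\psi(\zeta))+\varepsilon|\zeta|^2$, and this is why $d$ is a
minimum with $x_1$. The mean value inequality on the embedded sphere then shows that $f(z)$ and
$f(\xi-x_1\nu)$ are spherically close.

Conversely, a polydisc about $z\in A_\alpha$ of size $cd$ in the normal and $c\sqrt d$ in the
tangential directions lies in some $A_\beta$, where $f$ is close to $L$. Cauchy estimates on the
coordinate discs, for $f-L$ or for $1/f$ when $L=\infty$, bound the weighted gradient. -/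

section SecondOrder

/-! ### Second-order estimates at a critical point -/

variable {V : Type*} [NormedAddCommGroup V] [NormedSpace ℝ V] {ψ : V → ℝ}

/-- A `C²` function with a critical point at the origin is Lipschitz on small balls, with a
constant proportional to the radius. -/
theorem ContDiffAt.exists_abs_sub_le_of_fderiv_eq_zero (h : ContDiffAt ℝ 2 ψ 0)
    (h1 : fderiv ℝ ψ 0 = 0) :
    ∃ K : ℝ, 0 < K ∧ ∃ r : ℝ, 0 < r ∧ ∀ x y : V, ‖x‖ < r → ‖y‖ < r →
      |ψ x - ψ y| ≤ K * max ‖x‖ ‖y‖ * ‖x - y‖ := by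
  have hd : ContDiffAt ℝ 1 (fderiv ℝ ψ) 0 := h.fderiv_right (by norm_num)
  have hO := (hd.differentiableAt (by norm_num)).isBigO_sub
  obtain ⟨K, hK, hO⟩ := hO.exists_pos
  have hdiff : ∀ᶠ x in 𝓝 (0 : V), DifferentiableAt ℝ ψ x := by
    filter_upwards [h.eventually (by norm_num)] with x hx
    exact hx.differentiableAt (by norm_num)
  obtain ⟨r, hr, hball⟩ := Metric.eventually_nhds_iff_ball.1 (hO.bound.and hdiff)
  refine ⟨K, hK, r, hr, fun x y hx hy => ?_⟩
  have hsub : ∀ z ∈ Metric.closedBall (0 : V) (max ‖x‖ ‖y‖), z ∈ Metric.ball (0 : V) r := by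
    intro z hz
    rw [mem_closedBall_zero_iff] at hz
    rw [mem_ball_zero_iff]
    exact hz.trans_lt (max_lt hx hy)
  refine (convex_closedBall (0 : V) (max ‖x‖ ‖y‖)).norm_image_sub_le_of_norm_fderiv_le (𝕜 := ℝ)
    (fun z hz => (hball z (hsub z hz)).2) (fun z hz => ?_) (by simp) (by simp)
  have := (hball z (hsub z hz)).1
  rw [h1, sub_zero, sub_zero] at this
  refine this.trans ?_
  rw [mem_closedBall_zero_iff] at hz
  gcongr

/-- A `C²` function with a critical zero at the origin is, up to an error of higher order, at most
its positive part at the endpoint along each segment from the origin. -/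
theorem ContDiffAt.exists_apply_smul_le_of_fderiv_eq_zero (h : ContDiffAt ℝ 2 ψ 0) (h0 : ψ 0 = 0)
    (h1 : fderiv ℝ ψ 0 = 0) {ε : ℝ} (hε : 0 < ε) :
    ∃ r : ℝ, 0 < r ∧ ∀ x : V, ‖x‖ < r → ∀ t ∈ Set.Icc (0 : ℝ) 1,
      ψ (t • x) ≤ max 0 (ψ x) + ε * ‖x‖ ^ 2 := by
  have hd : ContDiffAt ℝ 1 (fderiv ℝ ψ) 0 := h.fderiv_right (by norm_num)
  have ho := (hd.differentiableAt (by norm_num)).hasFDerivAt.isLittleO.def (half_pos hε)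
  set A := fderiv ℝ (fderiv ℝ ψ) 0 with hA
  have hdiff : ∀ᶠ x in 𝓝 (0 : V), DifferentiableAt ℝ ψ x := by
    filter_upwards [h.eventually (by norm_num)] with x hx
    exact hx.differentiableAt (by norm_num)
  obtain ⟨r, hr, hball⟩ := Metric.eventually_nhds_iff_ball.1 (ho.and hdiff)
  -- Taylor's formula with form $Q=A(x,x)$, by the mean value inequality for
  -- $s\mapsto\psi(sx)-s^2Q/2$ on $[0,1]$.
  have key : ∀ x : V, ‖x‖ < r → |ψ x - A x x / 2| ≤ ε / 2 * ‖x‖ ^ 2 := by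
    intro x hx
    have hmem : ∀ t ∈ Set.Icc (0 : ℝ) 1, t • x ∈ Metric.ball (0 : V) r := by
      intro t ht
      rw [mem_ball_zero_iff, norm_smul, Real.norm_eq_abs, abs_of_nonneg ht.1]
      nlinarith [ht.2, norm_nonneg x]
    have hder : ∀ t ∈ Set.Icc (0 : ℝ) 1,
        HasDerivAt (fun s : ℝ => ψ (s • x) - s ^ 2 * (A x x / 2))
          (fderiv ℝ ψ (t • x) x - A (t • x) x) t := by
      intro t ht
      have e1 : HasDerivAt (fun s : ℝ => s • x) x t := by
        simpa using (hasDerivAt_id t).smul_const x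
      have e2 := (hball _ (hmem t ht)).2.hasFDerivAt.comp_hasDerivAt t e1
      have e3 : HasDerivAt (fun s : ℝ => s ^ 2 * (A x x / 2)) (A (t • x) x) t := by
        refine ((hasDerivAt_pow 2 t).mul_const (A x x / 2)).congr_deriv ?_
        rw [map_smul, smul_apply, smul_eq_mul]
        push_cast
        ring
      exact e2.sub e3
    have := norm_image_sub_le_of_norm_deriv_le_segment_01'
      (fun t ht => (hder t ht).hasDerivWithinAt) (C := ε / 2 * ‖x‖ ^ 2) (fun t ht => by
        have ht' : t ∈ Set.Icc (0 : ℝ) 1 := ⟨ht.1, ht.2.le⟩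
        have hb := (hball _ (hmem t ht')).1
        rw [h1, sub_zero, sub_zero] at hb
        have hn : ‖t • x‖ ≤ ‖x‖ := by
          rw [norm_smul, Real.norm_eq_abs, abs_of_nonneg ht.1]
          nlinarith [ht.2, norm_nonneg x]
        calc ‖fderiv ℝ ψ (t • x) x - A (t • x) x‖ = ‖(fderiv ℝ ψ (t • x) - A (t • x)) x‖ := by simp
          _ ≤ ‖fderiv ℝ ψ (t • x) - A (t • x)‖ * ‖x‖ := ContinuousLinearMap.le_opNorm _ _
          _ ≤ (ε / 2 * ‖x‖) * ‖x‖ := by gcongr; exact hb.trans (by gcongr)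
          _ = ε / 2 * ‖x‖ ^ 2 := by ring)
    simpa [h0] using this
  refine ⟨r, hr, fun x hx t ht => ?_⟩
  have hn : ‖t • x‖ ≤ ‖x‖ := by
    rw [norm_smul, Real.norm_eq_abs, abs_of_nonneg ht.1]
    nlinarith [ht.2, norm_nonneg x]
  have k1 := abs_le.1 (key x hx)
  have k2 := abs_le.1 (key (t • x) (hn.trans_lt hx))
  have k3 : ε / 2 * ‖t • x‖ ^ 2 ≤ ε / 2 * ‖x‖ ^ 2 := by gcongr
  have k4 : A (t • x) (t • x) = t ^ 2 * A x x := by simp; ring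
  have ht2 : t ^ 2 ≤ 1 := by nlinarith [ht.1, ht.2]
  rw [k4] at k2
  -- If $Q\le0$, the main term $t^2Q/2$ of $\psi(tx)$ is nonpositive; if $Q\ge0$, it is at most the
  -- main term $Q/2$ of $\psi(x)$.
  rcases le_total (A x x) 0 with hQ | hQ
  · nlinarith [le_max_left 0 (ψ x), sq_nonneg t]
  · nlinarith [le_max_right 0 (ψ x), sq_nonneg t]

end SecondOrder

/-! ### The Riemann sphere embedded in $\mathbb C\times\mathbb R$ -/

section Sphere

/-- The inverse stereographic projection `w ↦ (w, 1) / (1 + |w|²)` onto the sphere of diameter one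
which touches the plane at `0`, seen from its north pole. -/
noncomputable def sphereEmbedding (w : ℂ) : ℂ × ℝ :=
  ((1 + ‖w‖ ^ 2 : ℝ)⁻¹ • w, (1 + ‖w‖ ^ 2)⁻¹)

/-- The image of a curve in `ℂ` on the sphere has speed at most three times its spherical
speed. -/
theorem HasDerivAt.exists_sphereEmbedding {w : ℝ → ℂ} {w' : ℂ} {t : ℝ} (h : HasDerivAt w w' t) :
    ∃ v, HasDerivAt (fun s => sphereEmbedding (w s)) v t ∧
      ‖v‖ ≤ 3 * ((1 + ‖w t‖ ^ 2)⁻¹ * ‖w'‖) := by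
  have hpos : 0 < 1 + ‖w t‖ ^ 2 := by positivity
  have h1 : HasDerivAt (fun s => 1 + ‖w s‖ ^ 2) (2 * Inner.inner ℝ (w t) w') t :=
    (h.norm_sq).const_add 1
  have h2 := h1.inv hpos.ne'
  have h3 := h2.smul h
  refine ⟨_, h3.prodMk h2, ?_⟩
  have hin : |Inner.inner ℝ (w t) w'| ≤ ‖w t‖ * ‖w'‖ := abs_real_inner_le_norm _ _
  have hinv : (1 + ‖w t‖ ^ 2)⁻¹ * (1 + ‖w t‖ ^ 2) = 1 := inv_mul_cancel₀ hpos.ne'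
  have hval : (fun s => 1 + ‖w s‖ ^ 2)⁻¹ t = (1 + ‖w t‖ ^ 2)⁻¹ := rfl
  rw [hval]
  generalize Inner.inner ℝ (w t) w' = I at hin ⊢
  set a := ‖w t‖ with ha
  set q := (1 + a ^ 2)⁻¹ with hq
  have hq0 : 0 < q := by positivity
  have ha0 : 0 ≤ a := norm_nonneg _
  have e : ‖-(2 * I) / (1 + a ^ 2) ^ 2‖ ≤ 2 * a * q * (q * ‖w'‖) := by
    rw [div_eq_mul_inv, ← inv_pow, ← hq, norm_mul, norm_neg, norm_mul, norm_pow,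
      Real.norm_of_nonneg hq0.le, Real.norm_eq_abs I]
    rw [Real.norm_of_nonneg zero_le_two]
    nlinarith [mul_le_mul_of_nonneg_right hin (sq_nonneg q)]
  have hqw : 0 ≤ q * ‖w'‖ := by positivity
  have haq : 2 * a * q ≤ 1 := by nlinarith [sq_nonneg (a - 1)]
  have haaq : a * a * q ≤ 1 := by nlinarith
  -- The product carries the max norm. With $q=(1+|w|^2)^{-1}$, the first component costs $q|w'|$
  -- from $w'$ and $2q|w'|$ from $q'$; the second costs only $q|w'|$.
  refine max_le ?_ ?_
  · refine (norm_add_le _ _).trans ?_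
    simp only [norm_smul]
    have : ‖-(2 * I) / (1 + a ^ 2) ^ 2‖ * a ≤ 2 * (q * ‖w'‖) := by
      refine (mul_le_mul_of_nonneg_right e ha0).trans ?_
      nlinarith
    rw [← ha, Real.norm_of_nonneg hq0.le]
    linarith
  · refine e.trans ?_
    nlinarith

/-- The extension of `sphereEmbedding` to the Riemann sphere. -/
noncomputable def sphereValue (L : OnePoint ℂ) : ℂ × ℝ :=
  L.elim 0 sphereEmbedding

theorem OnePoint.tendsto_coe_iff_tendsto_coe {ι X : Type*} [TopologicalSpace X] {l : Filter ι}
    {f : ι → X} {x : X} :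
    Tendsto (fun i => (f i : OnePoint X)) l (𝓝 x) ↔ Tendsto f l (𝓝 x) :=
  OnePoint.isOpenEmbedding_coe.tendsto_nhds_iff.symm

theorem OnePoint.tendsto_coe_infty_iff_norm {ι E : Type*} [NormedAddCommGroup E] [ProperSpace E]
    {l : Filter ι} {f : ι → E} :
    Tendsto (fun i => (f i : OnePoint E)) l (𝓝 OnePoint.infty) ↔
      Tendsto (fun i => ‖f i‖) l atTop := by
  rw [show (fun i => (f i : OnePoint E)) = ((↑) : E → OnePoint E) ∘ f from rfl,
    ← tendsto_comap_iff, OnePoint.comap_coe_nhds_infty, Filter.coclosedCompact_eq_cocompact,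
    ← Metric.cobounded_eq_cocompact, ← comap_norm_atTop, tendsto_comap_iff]
  rfl

/-- A finite $w$ is recovered continuously as the quotient of the two components, while $\infty$
sits at the origin and is approached exactly when $(1+|w|^2)^{-1}\to0$. This turns convergence in
the sphere into convergence in a normed space, where the mean value inequality is available. -/
theorem OnePoint.tendsto_iff_sphereEmbedding {ι : Type*} {l : Filter ι} {f : ι → ℂ}
    {L : OnePoint ℂ} :
    Tendsto (fun i => (f i : OnePoint ℂ)) l (𝓝 L) ↔
      Tendsto (fun i => sphereEmbedding (f i)) l (𝓝 (sphereValue L)) := by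
  induction L using OnePoint.rec with
  | coe w =>
    rw [OnePoint.tendsto_coe_iff_tendsto_coe]
    have hv : sphereValue w = sphereEmbedding w := rfl
    rw [hv]
    constructor
    · intro h
      have hc : Continuous sphereEmbedding := by
        unfold sphereEmbedding
        have : Continuous fun w : ℂ => (1 + ‖w‖ ^ 2)⁻¹ :=
          (by fun_prop : Continuous fun w : ℂ => 1 + ‖w‖ ^ 2).inv₀ fun w => by positivity
        exact (this.smul continuous_id).prodMk this
      exact (hc.tendsto w).comp h
    · intro h
      have hi : ∀ w : ℂ, (sphereEmbedding w).2⁻¹ • (sphereEmbedding w).1 = w := by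
        intro w
        have : (1 + ‖w‖ ^ 2 : ℝ) ≠ 0 := by positivity
        simp only [sphereEmbedding, smul_smul]
        rw [inv_mul_cancel₀ (inv_ne_zero this), one_smul]
      have h2 : (sphereEmbedding w).2 ≠ 0 := by
        simp only [sphereEmbedding]
        positivity
      have := (h.snd_nhds.inv₀ h2).smul h.fst_nhds
      simpa only [hi] using this
  | infty =>
    rw [OnePoint.tendsto_coe_infty_iff_norm]
    have hv : sphereValue OnePoint.infty = (0, 0) := rfl
    rw [hv]
    constructor
    · intro h
      have hinv := tendsto_inv_atTop_zero.comp h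
      refine Tendsto.prodMk_nhds ?_ ?_
      · refine squeeze_zero_norm' ?_ hinv
        filter_upwards [h.eventually_gt_atTop 0] with i hi
        simp only [norm_smul, norm_inv, Function.comp_apply]
        rw [Real.norm_of_nonneg (by positivity), inv_mul_eq_div, div_le_iff₀ (by positivity)]
        field_simp
        linarith
      · refine tendsto_inv_atTop_zero.comp (tendsto_atTop_add_const_left _ _ ?_)
        exact (tendsto_pow_atTop two_ne_zero).comp h
    · intro h
      have h2 : Tendsto (fun i => (1 + ‖f i‖ ^ 2)⁻¹) l (𝓝[>] 0) :=
        tendsto_nhdsWithin_iff.2 ⟨h.snd_nhds, .of_forall fun i => by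
          rw [Set.mem_Ioi]; positivity⟩
      have h3 := tendsto_inv_nhdsGT_zero.comp h2
      rw [tendsto_atTop] at h3 ⊢
      intro M
      filter_upwards [h3 (1 + M ^ 2)] with i hi
      simp only [Function.comp_apply, inv_inv] at hi
      have := sq_le_sq.1 (by linarith : M ^ 2 ≤ ‖f i‖ ^ 2)
      rw [abs_norm] at this
      exact (le_abs_self M).trans this

end Sphere

/-! ### Cauchy estimates for the spherical derivative -/

section Cauchy

theorem inv_one_add_norm_sq_mul_norm_deriv_le {g : ℂ → ℂ} {z L : ℂ} {R ε : ℝ} (hR : 0 < R)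
    (hg : ∀ w ∈ Metric.closedBall z R, DifferentiableAt ℂ g w)
    (hb : ∀ w ∈ Metric.closedBall z R, ‖g w - L‖ ≤ ε) :
    (1 + ‖g z‖ ^ 2)⁻¹ * ‖deriv g z‖ ≤ ε / R := by
  have h1 : ‖deriv (fun w => g w - L) z‖ ≤ ε / R :=
    Complex.norm_deriv_le_of_forall_mem_sphere_norm_le hR
      (DifferentiableOn.diffContOnCl fun w hw => by
        rw [closure_ball z hR.ne'] at hw
        exact ((hg w hw).sub_const L).differentiableWithinAt)
      fun w hw => hb w (Metric.sphere_subset_closedBall hw)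
  rw [deriv_sub_const] at h1
  refine le_trans ?_ h1
  exact mul_le_of_le_one_left (norm_nonneg _) (inv_le_one_of_one_le₀ (by nlinarith [sq_nonneg ‖g z‖]))

/-- The Cauchy estimate is applied to $1/g$, since $|g'|/(1+|g|^2)\le|g'|/|g|^2=|(1/g)'|$. -/
theorem inv_one_add_norm_sq_mul_norm_deriv_le_of_le_norm {g : ℂ → ℂ} {z : ℂ} {R ε : ℝ}
    (hR : 0 < R) (hε : 0 < ε)
    (hg : ∀ w ∈ Metric.closedBall z R, DifferentiableAt ℂ g w)
    (hb : ∀ w ∈ Metric.closedBall z R, ε⁻¹ ≤ ‖g w‖) :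
    (1 + ‖g z‖ ^ 2)⁻¹ * ‖deriv g z‖ ≤ ε / R := by
  have hne : ∀ w ∈ Metric.closedBall z R, g w ≠ 0 := fun w hw h => by
    have := hb w hw
    rw [h, norm_zero] at this
    exact absurd this (not_le.2 (inv_pos.2 hε))
  have hz : z ∈ Metric.closedBall z R := Metric.mem_closedBall_self hR.le
  have h1 : ‖deriv (fun w => (g w)⁻¹) z‖ ≤ ε / R :=
    Complex.norm_deriv_le_of_forall_mem_sphere_norm_le hR
      (DifferentiableOn.diffContOnCl fun w hw => by
        rw [closure_ball z hR.ne'] at hw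
        exact ((hg w hw).inv (hne w hw)).differentiableWithinAt)
      fun w hw => by
        rw [norm_inv]
        exact inv_le_of_inv_le₀ hε (hb w (Metric.sphere_subset_closedBall hw))
  rw [deriv_fun_inv'' (hg z hz) (hne z hz), norm_div, norm_neg, norm_pow] at h1
  refine le_trans ?_ h1
  rw [inv_mul_eq_div]
  have : 0 < ‖g z‖ := norm_pos_iff.2 (hne z hz)
  gcongr
  linarith

end Cauchy

/-! ### The coordinates $z_1$ and $\zeta$ -/

section Coordinates

variable {n : ℕ} {D : Set (EuclideanSpace ℂ (Fin n))} {ξ ν : EuclideanSpace ℂ (Fin n)}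
  {ψ : realTangent ν → ℝ}

theorem EuclideanSpace.real_inner_eq_re_inner (v w : EuclideanSpace ℂ (Fin n)) :
    inner ℝ v w = (inner ℂ v w).re := by
  simp [PiLp.inner_apply]

theorem norm_normalCoord_eq (z : EuclideanSpace ℂ (Fin n)) :
    ‖normalCoord ξ ν z‖ = ‖inner ℂ ν (z - ξ)‖ := by
  rw [normalCoord, inner_neg_left, norm_neg]

theorem norm_normalCoord_le (hν : ‖ν‖ = 1) (z : EuclideanSpace ℂ (Fin n)) :
    ‖normalCoord ξ ν z‖ ≤ ‖z - ξ‖ := by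
  rw [norm_normalCoord_eq]
  exact (norm_inner_le_norm (𝕜 := ℂ) ν (z - ξ)).trans_eq (by rw [hν, one_mul])

theorem abs_re_normalCoord_le (hν : ‖ν‖ = 1) (z : EuclideanSpace ℂ (Fin n)) :
    |(normalCoord ξ ν z).re| ≤ ‖z - ξ‖ :=
  (Complex.abs_re_le_norm _).trans (norm_normalCoord_le hν z)

theorem re_normalCoord_sub_le (hν : ‖ν‖ = 1) (z w : EuclideanSpace ℂ (Fin n)) :
    (normalCoord ξ ν z).re - (normalCoord ξ ν w).re ≤ ‖z - w‖ := by
  have h : normalCoord ξ ν z - normalCoord ξ ν w = normalCoord w ν z := by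
    simp only [normalCoord, ← inner_sub_right]
    congr 1
    abel
  rw [← Complex.sub_re, h]
  exact (le_abs_self _).trans (abs_re_normalCoord_le hν z)

theorem tangentCoord_sub (z w : EuclideanSpace ℂ (Fin n)) :
    tangentCoord ξ ν z - tangentCoord ξ ν w = tangentCoord w ν z := by
  simp only [tangentCoord, ← map_sub]
  congr 1
  abel

theorem norm_tangentCoord_le (z : EuclideanSpace ℂ (Fin n)) :
    ‖tangentCoord ξ ν z‖ ≤ ‖z - ξ‖ :=
  Submodule.norm_orthogonalProjectionOnto_apply_le _ _

theorem tangentCoord_self : tangentCoord ξ ν ξ = 0 := by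
  simp [tangentCoord]

theorem normalCoord_self : normalCoord ξ ν ξ = 0 := by
  simp [normalCoord]

/-- The form $\xi+tv-s\nu$ covers both segments towards the normal and shifts along it; the shift is
invisible to $\zeta$. -/
theorem tangentCoord_add_smul_sub_smul (v : EuclideanSpace ℂ (Fin n)) (t s : ℝ) :
    tangentCoord ξ ν (ξ + t • v - s • ν) = t • tangentCoord ξ ν (ξ + v) := by
  have hν : (realTangent ν).orthogonalProjectionOnto ν = 0 := by
    rw [Submodule.orthogonalProjectionOnto_eq_zero_iff, Submodule.orthogonal_orthogonal]
    exact Submodule.mem_span_singleton_self ν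
  simp only [tangentCoord]
  rw [show ξ + t • v - s • ν - ξ = t • v - s • ν by abel, add_sub_cancel_left, map_sub, map_smul,
    map_smul, hν, smul_zero, sub_zero]

theorem tangentCoord_add_coe (v : realTangent ν) : tangentCoord ξ ν (ξ + v) = v := by
  simp [tangentCoord]

theorem normalCoord_add_smul_sub_smul (hν : ‖ν‖ = 1) (v : EuclideanSpace ℂ (Fin n)) (t s : ℝ) :
    normalCoord ξ ν (ξ + t • v - s • ν) = t * normalCoord ξ ν (ξ + v) + s := by
  have h1 : inner ℂ ν ν = 1 := by
    rw [inner_self_eq_norm_sq_to_K, hν]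
    simp
  simp only [normalCoord]
  rw [show ξ + t • v - s • ν - ξ = (t : ℂ) • v - (s : ℂ) • ν by simp; abel, add_sub_cancel_left,
    inner_sub_right, inner_smul_right, inner_smul_right, inner_neg_left ν ν, h1]
  ring

theorem re_normalCoord_add_coe (v : realTangent ν) : (normalCoord ξ ν (ξ + v)).re = 0 := by
  have := Submodule.mem_orthogonal_singleton_iff_inner_right.1 v.2
  rw [EuclideanSpace.real_inner_eq_re_inner] at this
  simp [normalCoord, inner_neg_left, this]

theorem continuous_tangentCoord : Continuous (tangentCoord ξ ν) := by
  unfold tangentCoord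
  fun_prop

theorem continuous_normalCoord : Continuous (normalCoord ξ ν) := by
  unfold normalCoord
  fun_prop

end Coordinates

/-! ### The boundary graph, and comparison of the approach regions -/

section Graph

variable {n : ℕ} {D : Set (EuclideanSpace ℂ (Fin n))} {ξ ν : EuclideanSpace ℂ (Fin n)}
  {ψ : realTangent ν → ℝ}

theorem HasDerivAt.eventually_pos_nhdsGT {g : ℝ → ℝ} {g' : ℝ} (h : HasDerivAt g g' 0)
    (h0 : g 0 = 0) (hg : 0 < g') : ∀ᶠ t in 𝓝[>] 0, 0 < g t := by
  have := (hasDerivAt_iff_tendsto_slope_zero.1 h).mono_left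
    (nhdsWithin_mono 0 fun t (ht : 0 < t) => ht.ne')
  filter_upwards [this.eventually_const_lt hg, self_mem_nhdsWithin] with t h1 ht
  rw [zero_add, h0, sub_zero, smul_eq_mul] at h1
  exact (pos_iff_pos_of_mul_pos h1).1 (inv_pos.2 ht)

theorem IsBoundaryGraphAt.apply_zero (hψ : IsBoundaryGraphAt D ξ ν ψ) (hD : IsOpen D)
    (hξ : ξ ∈ frontier D) : ψ 0 = 0 := by
  have hx : Continuous fun z => (normalCoord ξ ν z).re :=
    Complex.continuous_re.comp continuous_normalCoord
  have hm := hψ.mem_iff.self_of_nhds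
  rw [tangentCoord_self, normalCoord_self, Complex.zero_re] at hm
  have hξD : ξ ∉ D := fun h => by
    rw [hD.frontier_eq] at hξ
    exact hξ.2 h
  refine le_antisymm (le_of_not_gt fun h => ?_) (not_lt.1 fun h => hξD (hm.2 h))
  have hψc : ContinuousAt (fun z => ψ (tangentCoord ξ ν z)) ξ := by
    refine ContinuousAt.comp (f := tangentCoord ξ ν) ?_ continuous_tangentCoord.continuousAt
    rw [tangentCoord_self]
    exact hψ.contDiffAt.continuousAt
  have hev : ∀ᶠ z in 𝓝 ξ, (normalCoord ξ ν z).re < ψ (tangentCoord ξ ν z) := by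
    refine hx.continuousAt.eventually_lt hψc ?_
    rwa [tangentCoord_self, normalCoord_self]
  refine mem_closure_iff_frequently.1 hξ.1 ?_
  filter_upwards [hev, hψ.mem_iff] with z h1 h2 h3
  exact h1.not_gt (h2.1 h3)

/-- If $d\psi(v)=a>0$, then along $u=v-(a/2)\nu$ the height $ta/2$ is below $\psi(tv)\approx ta$, so
$\xi+tu\notin D$ for small $t>0$; but $d\rho(u)=-ca/2<0$ puts it in $D$. The same for $-v$ gives
equality. -/
theorem IsBoundaryGraphAt.fderiv_eq_zero (hψ : IsBoundaryGraphAt D ξ ν ψ) (hD : IsOpen D)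
    (hξ : ξ ∈ frontier D) (hν : IsUnitOutwardNormal D ξ ν) : fderiv ℝ ψ 0 = 0 := by
  have hψ0 := hψ.apply_zero hD hξ
  obtain ⟨hν1, ρ, hρ, c, hc, hg⟩ := hν
  have hρ0 := hρ.apply_eq_zero hξ
  have key : ∀ v, fderiv ℝ ψ 0 v ≤ 0 := by
    intro v
    by_contra! ha
    set a := fderiv ℝ ψ 0 v
    set u : EuclideanSpace ℂ (Fin n) := v - (a / 2) • ν with hu
    have hγ : ∀ t : ℝ, ξ + t • u = ξ + t • (v : EuclideanSpace ℂ (Fin n)) - (t * (a / 2)) • ν := by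
      intro t
      rw [hu]
      module
    have hγ0 : ξ + (0 : ℝ) • u = ξ := by simp
    have d1 : HasDerivAt (fun t : ℝ => ξ + t • u) u 0 := by
      simpa using ((hasDerivAt_id (0 : ℝ)).smul_const u).const_add ξ
    have d2 : HasDerivAt (fun t : ℝ => -ρ (ξ + t • u)) (c * (a / 2)) 0 := by
      have hρd : HasFDerivAt ρ (fderiv ℝ ρ ξ) (ξ + (0 : ℝ) • u) := by
        rw [hγ0]
        exact (hρ.contDiffAt.differentiableAt (by norm_num)).hasFDerivAt
      refine (hρd.comp_hasDerivAt 0 d1).neg.congr_deriv ?_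
      have hv : inner ℝ ν (v : EuclideanSpace ℂ (Fin n)) = 0 :=
        Submodule.mem_orthogonal_singleton_iff_inner_right.1 v.2
      rw [hg, ← EuclideanSpace.real_inner_eq_re_inner, hu, inner_sub_right, hv, real_inner_smul_right,
        real_inner_self_eq_norm_sq, hν1]
      ring
    have d3 : HasDerivAt (fun t : ℝ => ψ (t • v) - t * (a / 2)) (a / 2) 0 := by
      have e1 : HasDerivAt (fun t : ℝ => t • v) v 0 := by
        simpa using (hasDerivAt_id (0 : ℝ)).smul_const v
      have hψd : HasFDerivAt ψ (fderiv ℝ ψ 0) ((0 : ℝ) • v) := by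
        rw [zero_smul]
        exact (hψ.contDiffAt.differentiableAt (by norm_num)).hasFDerivAt
      refine ((hψd.comp_hasDerivAt 0 e1).sub ((hasDerivAt_id (0 : ℝ)).mul_const (a / 2))).congr_deriv
        ?_
      change a - 1 * (a / 2) = a / 2
      ring
    have p1 := d2.eventually_pos_nhdsGT (by rw [hγ0, hρ0, neg_zero]) (by positivity)
    have p2 := d3.eventually_pos_nhdsGT (by simp [hψ0]) (by positivity)
    have hlim : Tendsto (fun t : ℝ => ξ + t • u) (𝓝[>] 0) (𝓝 ξ) := by
      have := d1.continuousAt.tendsto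
      rw [hγ0] at this
      exact this.mono_left nhdsWithin_le_nhds
    obtain ⟨t, h1, h2, h3, h4⟩ :=
      (p1.and (p2.and (hlim.eventually (hρ.mem_iff.and hψ.mem_iff)))).exists
    rw [h3, hγ t, tangentCoord_add_smul_sub_smul, normalCoord_add_smul_sub_smul hν1,
      tangentCoord_add_coe, Complex.add_re, Complex.re_ofReal_mul, re_normalCoord_add_coe,
      ← hγ t, Complex.ofReal_re] at h4
    linarith [h4.1 (by linarith)]
  ext v
  have h1 := key v
  have h2 := key (-v)
  rw [map_neg] at h2
  exact le_antisymm h1 (by simpa using h2)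

/-- Quantitative form of the boundary being a `C²` graph over the tangent space. -/
theorem IsBoundaryGraphAt.exists_lipschitz (hψ : IsBoundaryGraphAt D ξ ν ψ) (hD : IsOpen D)
    (hξ : ξ ∈ frontier D) (hν : IsUnitOutwardNormal D ξ ν) :
    ∃ K : ℝ, 0 < K ∧ ∃ r : ℝ, 0 < r ∧
      (∀ z w, ‖z - ξ‖ < r → ‖w - ξ‖ < r →
        |ψ (tangentCoord ξ ν z) - ψ (tangentCoord ξ ν w)| ≤
          K * max ‖z - ξ‖ ‖w - ξ‖ * ‖z - w‖) ∧
      ∀ z, ‖z - ξ‖ < r → |ψ (tangentCoord ξ ν z)| ≤ K * ‖z - ξ‖ ^ 2 := by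
  obtain ⟨K, hK, r, hr, h⟩ :=
    hψ.contDiffAt.exists_abs_sub_le_of_fderiv_eq_zero (hψ.fderiv_eq_zero hD hξ hν)
  have hl : ∀ z w, ‖z - ξ‖ < r → ‖w - ξ‖ < r →
        |ψ (tangentCoord ξ ν z) - ψ (tangentCoord ξ ν w)| ≤
          K * max ‖z - ξ‖ ‖w - ξ‖ * ‖z - w‖ := by
    intro z w hz hw
    have hz' := norm_tangentCoord_le (ξ := ξ) (ν := ν) z
    have hw' := norm_tangentCoord_le (ξ := ξ) (ν := ν) w
    refine (h _ _ (hz'.trans_lt hz) (hw'.trans_lt hw)).trans ?_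
    have := norm_tangentCoord_le (ξ := w) (ν := ν) z
    rw [← tangentCoord_sub (ξ := ξ)] at this
    gcongr
  refine ⟨K, hK, r, hr, hl, fun z hz => ?_⟩
  have := hl z ξ hz (by simpa using hr)
  rw [tangentCoord_self, hψ.apply_zero hD hξ, sub_self, sub_zero, norm_zero,
    max_eq_left (norm_nonneg _)] at this
  linarith

/-- Lower bound: $x_1-\psi$ is $2$-Lipschitz near $\xi$ and nonpositive on $\partial D$. Upper
bound: the point of the graph below $z$ is outside $D$, and the nearest point of the complement lies
on $\partial D$. -/
theorem IsBoundaryGraphAt.eventually_infDist_frontier (hψ : IsBoundaryGraphAt D ξ ν ψ)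
    (hD : IsOpen D) (hξ : ξ ∈ frontier D) (hν : IsUnitOutwardNormal D ξ ν) :
    ∀ᶠ z in 𝓝 ξ, z ∈ D →
      ((normalCoord ξ ν z).re - ψ (tangentCoord ξ ν z)) / 2 ≤ Metric.infDist z (frontier D) ∧
        Metric.infDist z (frontier D) ≤ (normalCoord ξ ν z).re - ψ (tangentCoord ξ ν z) := by
  obtain ⟨K, hK, r, hr, hl, hq⟩ := hψ.exists_lipschitz hD hξ hν
  have hν1 := hν.1
  obtain ⟨r', hr', hmem⟩ := Metric.eventually_nhds_iff.1 hψ.mem_iff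
  -- The bound $KR\le1$ makes $\psi$ $1$-Lipschitz on this ball. Boundary points outside it are
  -- farther from $z$ than $|z-\xi|\ge s/2$, as $|z-\xi|<R/4$.
  set R := min (min r r') (1 / K) with hR
  have hR0 : 0 < R := by positivity
  have hRr : R ≤ r := (min_le_left _ _).trans (min_le_left _ _)
  have hRr' : R ≤ r' := (min_le_left _ _).trans (min_le_right _ _)
  have hRK : K * R ≤ 1 := by
    have : R ≤ 1 / K := min_le_right _ _
    calc K * R ≤ K * (1 / K) := by gcongr
      _ = 1 := by field_simp
  filter_upwards [Metric.ball_mem_nhds ξ (show 0 < R / 4 by positivity)] with z hz hzD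
  rw [Metric.mem_ball, dist_eq_norm] at hz
  have hψz := abs_le.1 (hq z (by linarith))
  have hxz := abs_le.1 (abs_re_normalCoord_le (ξ := ξ) hν1 z)
  have hn := norm_nonneg (z - ξ)
  have hKz : K * ‖z - ξ‖ ^ 2 ≤ ‖z - ξ‖ := by nlinarith
  have hpos := (hmem (y := z) (by rw [dist_eq_norm]; linarith)).1 hzD
  set s := (normalCoord ξ ν z).re - ψ (tangentCoord ξ ν z) with hs
  have hs0 : 0 < s := sub_pos.2 hpos
  have hsz : s ≤ 2 * ‖z - ξ‖ := by linarith [hxz.2, hψz.1]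
  constructor
  · refine (Metric.le_infDist ⟨ξ, hξ⟩).2 fun p hp => ?_
    rw [dist_eq_norm]
    by_cases hpR : ‖p - ξ‖ < R
    · have hpD : p ∉ D := by
        rw [hD.frontier_eq] at hp
        exact hp.2
      rw [hmem (by rw [dist_eq_norm]; linarith), not_lt] at hpD
      have h1 := re_normalCoord_sub_le (ξ := ξ) hν1 z p
      have h2 := (abs_le.1 (hl z p (by linarith) (by linarith))).1
      have h3 : K * max ‖z - ξ‖ ‖p - ξ‖ * ‖z - p‖ ≤ 1 * ‖z - p‖ := by
        gcongr
        refine le_trans ?_ hRK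
        gcongr
        exact max_le (by linarith) hpR.le
      linarith
    · have : ‖p - ξ‖ ≤ ‖z - p‖ + ‖z - ξ‖ := by
        rw [norm_sub_rev z p, ← sub_add_sub_cancel p z ξ]
        exact norm_add_le _ _
      push Not at hpR
      linarith
  · set p := ξ + (1 : ℝ) • (z - ξ) - (-s) • ν with hp
    have hzp : ‖z - p‖ = s := by
      rw [hp, show z - (ξ + (1 : ℝ) • (z - ξ) - (-s) • ν) = (-s) • ν by module, norm_smul, hν1,
        norm_neg, Real.norm_of_nonneg hs0.le, mul_one]
    have hpD : p ∉ D := by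
      have : ‖p - ξ‖ ≤ ‖z - p‖ + ‖z - ξ‖ := by
        rw [norm_sub_rev z p, ← sub_add_sub_cancel p z ξ]
        exact norm_add_le _ _
      rw [hmem (by rw [dist_eq_norm]; linarith), hp, tangentCoord_add_smul_sub_smul,
        normalCoord_add_smul_sub_smul hν1, add_sub_cancel, one_smul, Complex.add_re,
        Complex.re_ofReal_mul, Complex.ofReal_re, hs]
      linarith
    obtain ⟨y, hy, hy'⟩ := exists_mem_frontier_infDist_compl_eq_dist hzD
      (fun h => hpD (h ▸ Set.mem_univ p))
    calc Metric.infDist z (frontier D) ≤ dist z y := Metric.infDist_le_dist_of_mem hy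
      _ = Metric.infDist z Dᶜ := hy'.symm
      _ ≤ dist z p := Metric.infDist_le_dist_of_mem hpD
      _ = s := by rw [dist_eq_norm, hzp]

theorem graphDist_le_re (z : EuclideanSpace ℂ (Fin n)) :
    graphDist ξ ν ψ z ≤ (normalCoord ξ ν z).re :=
  min_le_left _ _

theorem graphDist_le_sub (z : EuclideanSpace ℂ (Fin n)) :
    graphDist ξ ν ψ z ≤ (normalCoord ξ ν z).re - ψ (tangentCoord ξ ν z) :=
  min_le_right _ _

theorem graphDist_pos_of_mem {α : ℝ} (hα : 0 < α) {z : EuclideanSpace ℂ (Fin n)}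
    (hz : z ∈ approachRegion D ξ ν ψ α) : 0 < graphDist ξ ν ψ z :=
  pos_of_mul_pos_right ((sq_nonneg _).trans_lt hz.2.1) hα.le

/-- On approach regions the distance to the tangent plane is controlled by `graphDist`. -/
theorem IsBoundaryGraphAt.exists_re_normalCoord_le (hψ : IsBoundaryGraphAt D ξ ν ψ)
    (hD : IsOpen D) (hξ : ξ ∈ frontier D) (hν : IsUnitOutwardNormal D ξ ν) {α : ℝ} (hα : 0 < α) :
    ∃ C : ℝ, 1 ≤ C ∧ ∀ᶠ z in 𝓝 ξ, z ∈ approachRegion D ξ ν ψ α →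
      (normalCoord ξ ν z).re ≤ C * graphDist ξ ν ψ z := by
  obtain ⟨K, hK, r, hr, -, hq⟩ := hψ.exists_lipschitz hD hξ hν
  refine ⟨1 + K * α, by nlinarith [mul_pos hK hα], ?_⟩
  filter_upwards [Metric.ball_mem_nhds ξ hr] with z hz hzA
  rw [Metric.mem_ball, dist_eq_norm] at hz
  have h1 := (le_abs_self _).trans (hq z hz)
  have h2 : K * ‖z - ξ‖ ^ 2 ≤ K * (α * graphDist ξ ν ψ z) := by
    gcongr
    exact hzA.2.1.le
  have hd := graphDist_pos_of_mem hα hzA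
  have h3 : 0 < K * (α * graphDist ξ ν ψ z) := by positivity
  -- On the region $\psi\le K|z-\xi|^2\le K\alpha d$, so $x_1$ exceeds $d$ by at most $K\alpha d$.
  have h4 : (normalCoord ξ ν z).re - K * (α * graphDist ξ ν ψ z) ≤ graphDist ξ ν ψ z :=
    le_min (by linarith) (by linarith)
  linarith

theorem IsBoundaryGraphAt.eventually_mem_approachRegion (hψ : IsBoundaryGraphAt D ξ ν ψ)
    (hD : IsOpen D) (hξ : ξ ∈ frontier D) (hν : IsUnitOutwardNormal D ξ ν) {α : ℝ} (hα : 0 < α) :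
    ∀ᶠ z in 𝓝 ξ, z ∈ admissibleDomain D ξ ν α → z ∈ approachRegion D ξ ν ψ (1 + α) := by
  filter_upwards [hψ.eventually_infDist_frontier hD hξ hν] with z hz ⟨hzD, h1, h2⟩
  have hδ : 0 < deltaAt D ξ ν z := pos_of_mul_pos_right ((sq_nonneg _).trans_lt h2) hα.le
  have hδx : deltaAt D ξ ν z ≤ (normalCoord ξ ν z).re := min_le_right _ _
  have hδd : deltaAt D ξ ν z ≤ graphDist ξ ν ψ z := min_le_min_right _ (hz hzD).2 |>.trans_eq
    (min_comm _ _)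
  refine ⟨hzD, ?_, ?_⟩
  · nlinarith
  · rw [← norm_normalCoord_eq] at h1
    have := Complex.abs_im_le_norm (normalCoord ξ ν z)
    nlinarith

/-- Here $d\le2\delta_\xi$ and $|z_1|\le x_1+|y_1|<(1+\alpha)x_1\le(1+\alpha)C\,d$, which dictates
$\beta$. -/
theorem IsBoundaryGraphAt.exists_eventually_mem_admissibleDomain (hψ : IsBoundaryGraphAt D ξ ν ψ)
    (hD : IsOpen D) (hξ : ξ ∈ frontier D) (hν : IsUnitOutwardNormal D ξ ν) {α : ℝ} (hα : 0 < α) :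
    ∃ β : ℝ, 0 < β ∧
      ∀ᶠ z in 𝓝 ξ, z ∈ approachRegion D ξ ν ψ α → z ∈ admissibleDomain D ξ ν β := by
  obtain ⟨C, hC, hx⟩ := hψ.exists_re_normalCoord_le hD hξ hν hα
  refine ⟨2 * (1 + α) * C, by positivity, ?_⟩
  filter_upwards [hx, hψ.eventually_infDist_frontier hD hξ hν] with z h1 h2 hzA
  have hd := graphDist_pos_of_mem hα hzA
  have h1 := h1 hzA
  obtain ⟨hzD, h3, h4⟩ := hzA
  have hδ : graphDist ξ ν ψ z ≤ 2 * deltaAt D ξ ν z := by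
    have e1 := graphDist_le_re (ξ := ξ) (ψ := ψ) z
    have e2 := graphDist_le_sub (ξ := ξ) (ψ := ψ) z
    have : graphDist ξ ν ψ z / 2 ≤ deltaAt D ξ ν z :=
      le_min (by linarith [(h2 hzD).1]) (by linarith)
    linarith
  have hδ0 : 0 < deltaAt D ξ ν z := by linarith
  have hCα : (1 + α) * 1 ≤ (1 + α) * C := by gcongr
  refine ⟨hzD, ?_, ?_⟩
  · rw [← norm_normalCoord_eq]
    have e1 := Complex.norm_le_abs_re_add_abs_im (normalCoord ξ ν z)
    rw [abs_of_pos (hd.trans_le (graphDist_le_re z))] at e1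
    have e2 : (1 + α) * (normalCoord ξ ν z).re ≤ (1 + α) * (C * (2 * deltaAt D ξ ν z)) := by
      gcongr
      exact h1.trans (by gcongr)
    linarith
  · have e1 : α * graphDist ξ ν ψ z ≤ α * (2 * deltaAt D ξ ν z) := by gcongr
    have e2 : 2 * ((1 + α) * 1) * deltaAt D ξ ν z ≤ 2 * ((1 + α) * C) * deltaAt D ξ ν z := by
      gcongr
    linarith

end Graph

/-! ### The weighted gradient and directional derivatives -/

section WeightedGradient

variable {n : ℕ} {D : Set (EuclideanSpace ℂ (Fin n))} {ξ ν : EuclideanSpace ℂ (Fin n)}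
  {ψ : realTangent ν → ℝ} {b : OrthonormalBasis (Fin n) ℂ (EuclideanSpace ℂ (Fin n))} {i : Fin n}
  {f : EuclideanSpace ℂ (Fin n) → ℂ} {z : EuclideanSpace ℂ (Fin n)}

theorem weightedGradient_nonneg : 0 ≤ weightedGradient ξ ν ψ b i f z := Real.sqrt_nonneg _

theorem graphDist_mul_norm_le_weightedGradient (hd : 0 < graphDist ξ ν ψ z) :
    graphDist ξ ν ψ z * ‖fderiv ℂ f z (b i)‖ ≤ weightedGradient ξ ν ψ b i f z := by
  refine Real.le_sqrt_of_sq_le ?_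
  rw [mul_pow]
  exact le_add_of_nonneg_right (mul_nonneg hd.le (Finset.sum_nonneg fun j _ => sq_nonneg _))

theorem sqrt_graphDist_mul_norm_le_weightedGradient (hd : 0 < graphDist ξ ν ψ z) {j : Fin n}
    (hj : j ≠ i) :
    √(graphDist ξ ν ψ z) * ‖fderiv ℂ f z (b j)‖ ≤ weightedGradient ξ ν ψ b i f z := by
  refine Real.le_sqrt_of_sq_le ?_
  rw [mul_pow, Real.sq_sqrt hd.le]
  refine le_add_of_nonneg_of_le (by positivity) ?_
  gcongr
  exact Finset.single_le_sum (f := fun j => ‖fderiv ℂ f z (b j)‖ ^ 2) (fun j _ => sq_nonneg _)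
    (Finset.mem_erase.2 ⟨hj, Finset.mem_univ j⟩)

/-- In the expansion of $k$ in the basis `b`, the normal coefficient $O(d)$ meets the weight $d$ and
the others, $O(\sqrt d)$, meet the weight $\sqrt d$. -/
theorem norm_fderiv_apply_le_weightedGradient (hd : 0 < graphDist ξ ν ψ z)
    {k : EuclideanSpace ℂ (Fin n)} {a c : ℝ} (ha : ‖inner ℂ (b i) k‖ ≤ a * graphDist ξ ν ψ z)
    (hc : ‖k‖ ≤ c * √(graphDist ξ ν ψ z)) :
    ‖fderiv ℂ f z k‖ ≤ (a + n * c) * weightedGradient ξ ν ψ b i f z := by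
  have hs : 0 < √(graphDist ξ ν ψ z) := Real.sqrt_pos.2 hd
  have ha0 : 0 ≤ a := nonneg_of_mul_nonneg_left ((norm_nonneg _).trans ha) hd
  have hc0 : 0 ≤ c := nonneg_of_mul_nonneg_left ((norm_nonneg _).trans hc) hs
  have hw : 0 ≤ weightedGradient ξ ν ψ b i f z := weightedGradient_nonneg
  have hk : fderiv ℂ f z k = ∑ j, inner ℂ (b j) k * fderiv ℂ f z (b j) := by
    conv_lhs => rw [← b.sum_repr' k]
    simp only [map_sum, map_smul, smul_eq_mul]
  rw [hk, ← Finset.add_sum_erase _ _ (Finset.mem_univ i)]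
  refine (norm_add_le _ _).trans ?_
  rw [add_mul]
  refine add_le_add ?_ ?_
  · rw [norm_mul]
    calc _ ≤ a * graphDist ξ ν ψ z * ‖fderiv ℂ f z (b i)‖ := by gcongr
      _ = a * (graphDist ξ ν ψ z * ‖fderiv ℂ f z (b i)‖) := by ring
      _ ≤ _ := by
        gcongr
        exact graphDist_mul_norm_le_weightedGradient hd
  · calc _ ≤ ∑ j ∈ Finset.univ.erase i, c * weightedGradient ξ ν ψ b i f z := by
          refine norm_sum_le_of_le _ fun j hj => ?_
          have h1 : ‖inner ℂ (b j) k‖ ≤ ‖k‖ :=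
            (norm_inner_le_norm (𝕜 := ℂ) (b j) k).trans_eq (by rw [b.norm_eq_one, one_mul])
          rw [norm_mul]
          calc _ ≤ c * √(graphDist ξ ν ψ z) * ‖fderiv ℂ f z (b j)‖ := by
                gcongr
                exact h1.trans hc
            _ = c * (√(graphDist ξ ν ψ z) * ‖fderiv ℂ f z (b j)‖) := by ring
            _ ≤ _ := by
              gcongr
              exact sqrt_graphDist_mul_norm_le_weightedGradient hd (Finset.ne_of_mem_erase hj)
      _ = ((Finset.univ.erase i).card : ℝ) * (c * weightedGradient ξ ν ψ b i f z) := by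
        rw [Finset.sum_const, nsmul_eq_mul]
      _ ≤ n * (c * weightedGradient ξ ν ψ b i f z) := by
        gcongr
        exact (Finset.card_le_univ _).trans_eq (Fintype.card_fin n)
      _ = _ := by ring

theorem weightedGradient_le (hd : 0 < graphDist ξ ν ψ z) {M : ℝ}
    (hi : graphDist ξ ν ψ z * ‖fderiv ℂ f z (b i)‖ ≤ M)
    (hj : ∀ j, j ≠ i → √(graphDist ξ ν ψ z) * ‖fderiv ℂ f z (b j)‖ ≤ M) :
    weightedGradient ξ ν ψ b i f z ≤ (1 + n) * M := by
  have hM : 0 ≤ M := (mul_nonneg hd.le (norm_nonneg _)).trans hi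
  refine Real.sqrt_le_iff.2 ⟨by positivity, ?_⟩
  have h1 : graphDist ξ ν ψ z ^ 2 * ‖fderiv ℂ f z (b i)‖ ^ 2 ≤ M ^ 2 := by
    rw [← mul_pow]
    gcongr
  have h2 : graphDist ξ ν ψ z * ∑ j ∈ Finset.univ.erase i, ‖fderiv ℂ f z (b j)‖ ^ 2 ≤
      n * M ^ 2 := by
    rw [Finset.mul_sum]
    calc _ ≤ ∑ j ∈ Finset.univ.erase i, M ^ 2 := by
          refine Finset.sum_le_sum fun j hj' => ?_
          have h3 := hj j (Finset.ne_of_mem_erase hj')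
          have h4 : graphDist ξ ν ψ z * ‖fderiv ℂ f z (b j)‖ ^ 2 =
              (√(graphDist ξ ν ψ z) * ‖fderiv ℂ f z (b j)‖) ^ 2 := by
            rw [mul_pow, Real.sq_sqrt hd.le]
          rw [h4]
          gcongr
      _ = ((Finset.univ.erase i).card : ℝ) * M ^ 2 := by rw [Finset.sum_const, nsmul_eq_mul]
      _ ≤ n * M ^ 2 := by
        gcongr
        exact (Finset.card_le_univ _).trans_eq (Fintype.card_fin n)
  nlinarith [sq_nonneg M, mul_nonneg (Nat.cast_nonneg (α := ℝ) n) (sq_nonneg M),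
    mul_nonneg (sq_nonneg (n : ℝ)) (sq_nonneg M)]

end WeightedGradient

/-! ### From the gradient condition to the limit -/

section Sufficiency

variable {n : ℕ} {D : Set (EuclideanSpace ℂ (Fin n))} {ξ ν : EuclideanSpace ℂ (Fin n)}
  {ψ : realTangent ν → ℝ}

/-- The segment from the point of the inner normal at height `x₁` to a point `z` of an approach
region at the same height stays in an approach region of twice the aperture. -/
theorem IsBoundaryGraphAt.eventually_segment_mem_approachRegion (hψ : IsBoundaryGraphAt D ξ ν ψ)
    (hD : IsOpen D) (hξ : ξ ∈ frontier D) (hν : IsUnitOutwardNormal D ξ ν) {α : ℝ} (hα : 0 < α) :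
    ∀ᶠ z in 𝓝 ξ, z ∈ approachRegion D ξ ν ψ α → ∀ t ∈ Set.Icc (0 : ℝ) 1,
      ξ + t • (z - ξ) - ((1 - t) * (normalCoord ξ ν z).re) • ν ∈ approachRegion D ξ ν ψ (2 * α) ∧
      graphDist ξ ν ψ z ≤
        2 * graphDist ξ ν ψ (ξ + t • (z - ξ) - ((1 - t) * (normalCoord ξ ν z).re) • ν) ∧
      ‖ξ + t • (z - ξ) - ((1 - t) * (normalCoord ξ ν z).re) • ν - ξ‖ ≤ ‖z - ξ‖ := by
  have hν1 := hν.1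
  -- As $|\zeta|^2\le|z-\xi|^2<\alpha d$, this $\varepsilon$ makes the error at most $d/2$; halving
  -- $d$ doubles the aperture.
  obtain ⟨r, hr, hh⟩ := hψ.contDiffAt.exists_apply_smul_le_of_fderiv_eq_zero
    (hψ.apply_zero hD hξ) (hψ.fderiv_eq_zero hD hξ hν) (ε := 1 / (2 * α)) (by positivity)
  obtain ⟨r', hr', hmem⟩ := Metric.eventually_nhds_iff.1 hψ.mem_iff
  filter_upwards [Metric.ball_mem_nhds ξ hr, Metric.ball_mem_nhds ξ hr'] with z hz hz' hzA t ht
  rw [Metric.mem_ball, dist_eq_norm] at hz hz'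
  have hd := graphDist_pos_of_mem hα hzA
  obtain ⟨-, h1, h2⟩ := hzA
  have hT := norm_tangentCoord_le (ξ := ξ) (ν := ν) z
  have hx : 0 < (normalCoord ξ ν z).re := hd.trans_le (graphDist_le_re z)
  have hdψ := graphDist_le_sub (ξ := ξ) (ψ := ψ) z
  have hdx := graphDist_le_re (ξ := ξ) (ψ := ψ) z
  have hxz := (le_abs_self _).trans (abs_re_normalCoord_le (ξ := ξ) hν1 z)
  set γ := ξ + t • (z - ξ) - ((1 - t) * (normalCoord ξ ν z).re) • ν with hγ
  have hTγ : tangentCoord ξ ν γ = t • tangentCoord ξ ν z := by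
    rw [hγ, tangentCoord_add_smul_sub_smul, add_sub_cancel]
  have hNγ : normalCoord ξ ν γ = t * normalCoord ξ ν z + ((1 - t) * (normalCoord ξ ν z).re : ℝ) := by
    rw [hγ, normalCoord_add_smul_sub_smul hν1, add_sub_cancel]
  have hre : (normalCoord ξ ν γ).re = (normalCoord ξ ν z).re := by
    rw [hNγ, Complex.add_re, Complex.re_ofReal_mul, Complex.ofReal_re]
    ring
  have him : (normalCoord ξ ν γ).im = t * (normalCoord ξ ν z).im := by
    rw [hNγ, Complex.add_im, Complex.im_ofReal_mul, Complex.ofReal_im, add_zero]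
  have hψγ := hh _ (hT.trans_lt hz) t ht
  have herr : 1 / (2 * α) * ‖tangentCoord ξ ν z‖ ^ 2 ≤ graphDist ξ ν ψ z / 2 := by
    calc _ ≤ 1 / (2 * α) * (α * graphDist ξ ν ψ z) := by
          gcongr
          exact (pow_le_pow_left₀ (norm_nonneg _) hT 2).trans h1.le
      _ = _ := by field_simp
  have hdγ : graphDist ξ ν ψ z / 2 ≤ graphDist ξ ν ψ γ := by
    refine le_min (by rw [hre]; linarith) ?_
    rw [hre, hTγ]
    have : max 0 (ψ (tangentCoord ξ ν z)) ≤ (normalCoord ξ ν z).re - graphDist ξ ν ψ z :=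
      max_le (by linarith) (by linarith)
    linarith
  have hγξ : ‖γ - ξ‖ ≤ ‖z - ξ‖ := by
    have : γ - ξ = t • (z - ξ) - ((1 - t) * (normalCoord ξ ν z).re) • ν := by
      rw [hγ]
      abel
    rw [this]
    refine (norm_sub_le _ _).trans ?_
    rw [norm_smul, norm_smul, hν1, Real.norm_of_nonneg ht.1,
      Real.norm_of_nonneg (mul_nonneg (sub_nonneg.2 ht.2) hx.le)]
    nlinarith [ht.2]
  refine ⟨⟨?_, ?_, ?_⟩, by linarith, hγξ⟩
  · rw [hmem (by rw [dist_eq_norm]; exact hγξ.trans_lt hz'), ← sub_pos]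
    exact lt_of_lt_of_le (by linarith) (graphDist_le_sub γ)
  · have : ‖γ - ξ‖ ^ 2 ≤ ‖z - ξ‖ ^ 2 := by gcongr
    nlinarith
  · rw [him, hre, abs_mul, abs_of_nonneg ht.1]
    nlinarith [abs_nonneg (normalCoord ξ ν z).im, ht.2]

theorem IsBoundaryGraphAt.tendsto_of_tendsto_weightedGradient (hψ : IsBoundaryGraphAt D ξ ν ψ)
    (hD : IsOpen D) (hξ : ξ ∈ frontier D) (hν : IsUnitOutwardNormal D ξ ν)
    {f : EuclideanSpace ℂ (Fin n) → ℂ} (hf : DifferentiableOn ℂ f D)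
    {b : OrthonormalBasis (Fin n) ℂ (EuclideanSpace ℂ (Fin n))} {i : Fin n} (hb : b i = -ν)
    {L : OnePoint ℂ} (hL : Tendsto (fun t : ℝ => (f (ξ - t • ν) : OnePoint ℂ)) (𝓝[>] 0) (𝓝 L))
    {α : ℝ} (hα : 0 < α)
    (hG : Tendsto (fun z => (1 + ‖f z‖ ^ 2)⁻¹ * weightedGradient ξ ν ψ b i f z)
      (𝓝[approachRegion D ξ ν ψ (2 * α)] ξ) (𝓝 0)) :
    Tendsto (fun z => (f z : OnePoint ℂ)) (𝓝[approachRegion D ξ ν ψ α] ξ) (𝓝 L) := by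
  have hν1 := hν.1
  rw [OnePoint.tendsto_iff_sphereEmbedding] at hL ⊢
  have hx : Tendsto (fun z => (normalCoord ξ ν z).re) (𝓝[approachRegion D ξ ν ψ α] ξ)
      (𝓝[>] 0) := by
    refine tendsto_nhdsWithin_iff.2 ⟨?_, ?_⟩
    · have : Continuous fun z => (normalCoord ξ ν z).re :=
        Complex.continuous_re.comp continuous_normalCoord
      have := this.tendsto ξ
      rw [normalCoord_self] at this
      exact this.mono_left nhdsWithin_le_nhds
    · filter_upwards [self_mem_nhdsWithin] with z hz
      exact (graphDist_pos_of_mem hα hz).trans_le (graphDist_le_re z)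
  refine (tendsto_iff_of_dist ?_).1 (hL.comp hx)
  obtain ⟨C, hC, hCx⟩ := hψ.exists_re_normalCoord_le hD hξ hν hα
  -- The two terms come from $|y_1|\le\alpha x_1\le2\alpha C\,d(\gamma)$ and
  -- $|k|\le2|z-\xi|\le2\sqrt{2\alpha\,d(\gamma)}$, with $\gamma$ on the segment and $k$ its
  -- velocity.
  set M := 2 * α * C + n * (2 * √(2 * α)) with hM
  have hM0 : 0 < M := by positivity
  rw [Metric.tendsto_nhds]
  intro ε hε
  have hε' : 0 < ε / (6 * M) := by positivity
  obtain ⟨r, hr, hGr⟩ := Metric.mem_nhdsWithin_iff.1 (hG.eventually (gt_mem_nhds hε'))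
  filter_upwards [self_mem_nhdsWithin, nhdsWithin_le_nhds (Metric.ball_mem_nhds ξ hr),
    nhdsWithin_le_nhds hCx,
    nhdsWithin_le_nhds (hψ.eventually_segment_mem_approachRegion hD hξ hν hα)] with z hzA hzr hzC hzS
  have hzC := hzC hzA
  have hzS := hzS hzA
  have hd := graphDist_pos_of_mem hα hzA
  have hxpos := hd.trans_le (graphDist_le_re z)
  set x := (normalCoord ξ ν z).re with hxdef
  let γ : ℝ → EuclideanSpace ℂ (Fin n) := fun t => ξ + t • (z - ξ) - ((1 - t) * x) • ν
  let k : EuclideanSpace ℂ (Fin n) := z - ξ + x • ν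
  have hγd : ∀ t, HasDerivAt γ k t := by
    intro t
    have e1 := ((hasDerivAt_id t).smul_const (z - ξ)).const_add ξ
    have e2 := (((hasDerivAt_id t).const_sub 1).mul_const x).smul_const ν
    refine (e1.sub e2).congr_deriv ?_
    simp only [k]
    module
  have hki : ‖inner ℂ (b i) k‖ = |(normalCoord ξ ν z).im| := by
    have h1 : inner ℂ ν ν = 1 := by
      rw [inner_self_eq_norm_sq_to_K, hν1]
      simp
    have : inner ℂ (b i) k = (normalCoord ξ ν z).im * Complex.I := by
      have e : k = z - ξ + (x : ℂ) • ν := by simp [k]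
      rw [e, hb, inner_add_right, inner_smul_right, inner_neg_left ν ν, h1]
      change normalCoord ξ ν z + _ = _
      conv_lhs => rw [← Complex.re_add_im (normalCoord ξ ν z)]
      rw [hxdef]
      ring
    rw [this, norm_mul, Complex.norm_I, mul_one, Complex.norm_real, Real.norm_eq_abs]
  have hkn : ‖k‖ ≤ 2 * ‖z - ξ‖ := by
    refine (norm_add_le _ _).trans ?_
    rw [norm_smul, hν1, mul_one, Real.norm_eq_abs]
    linarith [abs_re_normalCoord_le (ξ := ξ) hν1 z]
  have hder : ∀ t ∈ Set.Icc (0 : ℝ) 1, ∃ v,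
      HasDerivAt (fun s => sphereEmbedding (f (γ s))) v t ∧ ‖v‖ ≤ ε / 2 := by
    intro t ht
    obtain ⟨hA, hdγ, hn⟩ := hzS t ht
    change γ t ∈ _ at hA
    change _ ≤ 2 * graphDist ξ ν ψ (γ t) at hdγ
    change ‖γ t - ξ‖ ≤ _ at hn
    have hd' : 0 < graphDist ξ ν ψ (γ t) := by linarith
    have hfd : HasDerivAt (fun s => f (γ s)) (fderiv ℂ f (γ t) k) t :=
      ((hf.differentiableAt (hD.mem_nhds hA.1)).hasFDerivAt.restrictScalars ℝ).comp_hasDerivAt t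
        (hγd t)
    obtain ⟨v, hv, hvn⟩ := hfd.exists_sphereEmbedding
    refine ⟨v, hv, hvn.trans ?_⟩
    have hb1 : ‖inner ℂ (b i) k‖ ≤ 2 * α * C * graphDist ξ ν ψ (γ t) := by
      rw [hki]
      calc _ ≤ α * x := hzA.2.2.le
        _ ≤ α * (C * (2 * graphDist ξ ν ψ (γ t))) := by
          gcongr
          exact hzC.trans (by gcongr)
        _ = _ := by ring
    have hb2 : ‖k‖ ≤ 2 * √(2 * α) * √(graphDist ξ ν ψ (γ t)) := by
      rw [mul_assoc, ← Real.sqrt_mul (by positivity)]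
      refine hkn.trans ?_
      gcongr
      refine Real.le_sqrt_of_sq_le (hzA.2.1.le.trans ?_)
      nlinarith
    have hb3 := norm_fderiv_apply_le_weightedGradient (f := f) hd' hb1 hb2
    have hb4 : (1 + ‖f (γ t)‖ ^ 2)⁻¹ * weightedGradient ξ ν ψ b i f (γ t) < ε / (6 * M) :=
      hGr ⟨by rw [Metric.mem_ball, dist_eq_norm] at hzr ⊢; exact hn.trans_lt hzr, hA⟩
    calc 3 * ((1 + ‖f (γ t)‖ ^ 2)⁻¹ * ‖fderiv ℂ f (γ t) k‖)
        ≤ 3 * ((1 + ‖f (γ t)‖ ^ 2)⁻¹ * (M * weightedGradient ξ ν ψ b i f (γ t))) := by gcongr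
      _ = 3 * M * ((1 + ‖f (γ t)‖ ^ 2)⁻¹ * weightedGradient ξ ν ψ b i f (γ t)) := by ring
      _ ≤ 3 * M * (ε / (6 * M)) := by gcongr
      _ = ε / 2 := by
        field_simp
        norm_num
  choose! v hv hvn using hder
  have hmv := norm_image_sub_le_of_norm_deriv_le_segment_01'
    (fun t ht => (hv t ht).hasDerivWithinAt) (fun t ht => hvn t ⟨ht.1, ht.2.le⟩)
  have hγ1 : γ 1 = z := by simp [γ]
  have hγ0 : γ 0 = ξ - x • ν := by simp [γ]
  rw [hγ1, hγ0] at hmv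
  rw [Real.dist_eq, sub_zero, abs_of_nonneg dist_nonneg, dist_comm, dist_eq_norm]
  exact hmv.trans_lt (by linarith)

end Sufficiency

/-! ### From the limit to the gradient condition -/

section Necessity

/-- A function of one variable with values close to a point of the Riemann sphere has small
spherical derivative. -/
theorem OnePoint.exists_mem_comap_nhds_spherical_deriv_le (L : OnePoint ℂ) {ε : ℝ} (hε : 0 < ε) :
    ∃ U ∈ comap ((↑) : ℂ → OnePoint ℂ) (𝓝 L), ∀ (g : ℂ → ℂ) (z : ℂ) (R : ℝ), 0 < R →
      (∀ w ∈ Metric.closedBall z R, DifferentiableAt ℂ g w) →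
      (∀ w ∈ Metric.closedBall z R, g w ∈ U) → (1 + ‖g z‖ ^ 2)⁻¹ * ‖deriv g z‖ ≤ ε / R := by
  induction L using OnePoint.rec with
  | coe a =>
    refine ⟨Metric.ball a ε, ?_, fun g z R hR hg hU => ?_⟩
    · rw [OnePoint.comap_coe_nhds]
      exact Metric.ball_mem_nhds a hε
    · refine inv_one_add_norm_sq_mul_norm_deriv_le (L := a) hR hg fun w hw => ?_
      rw [← dist_eq_norm]
      exact (hU w hw).le
  | infty =>
    have h : Tendsto (fun w : ℂ => (w : OnePoint ℂ)) (comap (↑) (𝓝 (OnePoint.infty : OnePoint ℂ)))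
        (𝓝 OnePoint.infty) := tendsto_comap
    refine ⟨{w | ε⁻¹ ≤ ‖w‖}, ?_, fun g z R hR hg hU => ?_⟩
    · exact (OnePoint.tendsto_coe_infty_iff_norm.1 h).eventually_ge_atTop ε⁻¹
    · exact inv_one_add_norm_sq_mul_norm_deriv_le_of_le_norm hR hε hg hU

variable {n : ℕ} {D : Set (EuclideanSpace ℂ (Fin n))} {ξ ν : EuclideanSpace ℂ (Fin n)}
  {ψ : realTangent ν → ℝ}

/-- Around each point of an approach region, a polydisc of radius comparable to `d` in the normal
direction and to `√d` in the tangential directions lies in a larger approach region. -/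
theorem IsBoundaryGraphAt.exists_polydisc_subset_approachRegion (hψ : IsBoundaryGraphAt D ξ ν ψ)
    (hD : IsOpen D) (hξ : ξ ∈ frontier D) (hν : IsUnitOutwardNormal D ξ ν) {α : ℝ} (hα : 0 < α) :
    ∃ c : ℝ, 0 < c ∧ c ≤ 1 ∧ ∃ β : ℝ, 0 < β ∧ ∀ᶠ z in 𝓝 ξ, z ∈ approachRegion D ξ ν ψ α → ∀ w,
      ‖w - z‖ ≤ c * √(graphDist ξ ν ψ z) →
      ‖normalCoord ξ ν w - normalCoord ξ ν z‖ ≤ c * graphDist ξ ν ψ z →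
      w ∈ approachRegion D ξ ν ψ β := by
  have hν1 := hν.1
  obtain ⟨K, hK, r, hr, hl, -⟩ := hψ.exists_lipschitz hD hξ hν
  obtain ⟨r', hr', hmem⟩ := Metric.eventually_nhds_iff.1 hψ.mem_iff
  have hsα := Real.sqrt_nonneg α
  have hden : 0 < 1 + K * (√α + 1) := by positivity
  -- On the polydisc $x_1$ changes by at most $cd$ and $\psi$ by at most $K(\sqrt\alpha+1)\sqrt
  -- d\cdot c\sqrt d$. These add up to $d/4$, so $d(w)\ge d/2$.
  set c := 1 / (4 * (1 + K * (√α + 1))) with hc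
  have hc0 : 0 < c := by positivity
  have hcK : c + K * (√α + 1) * c = 1 / 4 := by
    rw [hc]
    field_simp
  have hKc : 0 < K * (√α + 1) * c := by positivity
  have hc4 : c ≤ 1 / 4 := by linarith
  refine ⟨c, hc0, by linarith, 2 * (√α + 1) ^ 2 + 2 * (α + 1), by positivity, ?_⟩
  have hnear : ∀ᶠ z in 𝓝 ξ, ‖z - ξ‖ + √‖z - ξ‖ < min r r' := by
    have : Continuous fun z => ‖z - ξ‖ + √‖z - ξ‖ := by fun_prop
    have := this.tendsto ξ
    rw [sub_self, norm_zero, Real.sqrt_zero, add_zero] at this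
    exact this.eventually_lt_const (lt_min hr hr')
  filter_upwards [hnear] with z hz hzA w hw1 hw2
  have hd := graphDist_pos_of_mem hα hzA
  obtain ⟨-, h1, h2⟩ := hzA
  have hdx := graphDist_le_re (ξ := ξ) (ψ := ψ) z
  have hdψ := graphDist_le_sub (ξ := ξ) (ψ := ψ) z
  have hxz := (le_abs_self _).trans (abs_re_normalCoord_le (ξ := ξ) hν1 z)
  set d := graphDist ξ ν ψ z with hddef
  have hs0 : 0 < √d := Real.sqrt_pos.2 hd
  have hsd : √d * √d = d := Real.mul_self_sqrt hd.le
  have hsz : √d ≤ √‖z - ξ‖ := Real.sqrt_le_sqrt (by linarith)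
  have hz1 : ‖z - ξ‖ ≤ √α * √d := by
    rw [← Real.sqrt_mul hα.le]
    exact Real.le_sqrt_of_sq_le h1.le
  have htri : ‖w - ξ‖ ≤ ‖w - z‖ + ‖z - ξ‖ := by
    rw [← sub_add_sub_cancel w z ξ]
    exact norm_add_le _ _
  have hcs : c * √d ≤ √d := by nlinarith
  have hwn : ‖w - ξ‖ < min r r' := by linarith
  have hw3 : ‖w - ξ‖ ≤ (√α + 1) * √d := by linarith
  have hzr : ‖z - ξ‖ < r := by
    linarith [Real.sqrt_nonneg ‖z - ξ‖, min_le_left r r']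
  have hF := (abs_le.1 (hl z w hzr (hwn.trans_le (min_le_left _ _)))).1
  have hF2 : K * max ‖z - ξ‖ ‖w - ξ‖ * ‖z - w‖ ≤ K * (√α + 1) * c * d := by
    rw [norm_sub_rev z w]
    calc _ ≤ K * ((√α + 1) * √d) * (c * √d) := by
          gcongr
          exact max_le (by linarith) hw3
      _ = K * (√α + 1) * c * (√d * √d) := by ring
      _ = _ := by rw [hsd]
  have hre := abs_le.1 ((Complex.abs_re_le_norm _).trans hw2)
  have him := (Complex.abs_im_le_norm _).trans hw2
  rw [Complex.sub_re] at hre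
  rw [Complex.sub_im] at him
  have hcd : c * d + K * (√α + 1) * c * d = d / 4 := by
    rw [← add_mul, hcK]
    ring
  have hKd : 0 < K * (√α + 1) * c * d := by positivity
  have hdw : d / 2 ≤ graphDist ξ ν ψ w := le_min (by linarith [hre.1]) (by linarith [hre.1])
  refine ⟨?_, ?_, ?_⟩
  · rw [hmem (by rw [dist_eq_norm]; exact hwn.trans_le (min_le_right _ _)), ← sub_pos]
    exact lt_of_lt_of_le (by linarith) (graphDist_le_sub w)
  · calc ‖w - ξ‖ ^ 2 ≤ ((√α + 1) * √d) ^ 2 := by gcongr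
      _ = (√α + 1) ^ 2 * d := by rw [mul_pow, pow_two (√d), hsd]
      _ ≤ (√α + 1) ^ 2 * (2 * graphDist ξ ν ψ w) := by
        gcongr
        linarith
      _ < _ := by nlinarith
  · have hxw : (normalCoord ξ ν z).re ≤ 2 * (normalCoord ξ ν w).re := by linarith [hre.1]
    have htri' := abs_sub_abs_le_abs_sub (normalCoord ξ ν w).im (normalCoord ξ ν z).im
    nlinarith [sq_nonneg (√α + 1)]

theorem IsBoundaryGraphAt.tendsto_weightedGradient (hψ : IsBoundaryGraphAt D ξ ν ψ)
    (hD : IsOpen D) (hξ : ξ ∈ frontier D) (hν : IsUnitOutwardNormal D ξ ν)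
    {f : EuclideanSpace ℂ (Fin n) → ℂ} (hf : DifferentiableOn ℂ f D)
    {b : OrthonormalBasis (Fin n) ℂ (EuclideanSpace ℂ (Fin n))} {i : Fin n} (hb : b i = -ν)
    {L : OnePoint ℂ}
    (hL : ∀ β : ℝ, 0 < β →
      Tendsto (fun z => (f z : OnePoint ℂ)) (𝓝[approachRegion D ξ ν ψ β] ξ) (𝓝 L))
    {α : ℝ} (hα : 0 < α) :
    Tendsto (fun z => (1 + ‖f z‖ ^ 2)⁻¹ * weightedGradient ξ ν ψ b i f z)
      (𝓝[approachRegion D ξ ν ψ α] ξ) (𝓝 0) := by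
  have hν1 := hν.1
  obtain ⟨c, hc, hc1, β, hβ, hpoly⟩ := hψ.exists_polydisc_subset_approachRegion hD hξ hν hα
  rw [Metric.tendsto_nhds]
  intro ε hε
  -- Chosen so that the final bound $(1+n)\eta/c$ equals $\varepsilon/2$.
  set η := c * ε / (2 * (1 + n)) with hη
  have hη0 : 0 < η := by positivity
  obtain ⟨U, hU, hder⟩ := OnePoint.exists_mem_comap_nhds_spherical_deriv_le L hη0
  obtain ⟨r, hr, hrU⟩ := Metric.mem_nhdsWithin_iff.1 (tendsto_comap_iff.2 (hL β hβ) hU)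
  have hnear : ∀ᶠ z in 𝓝 ξ, ‖z - ξ‖ + √‖z - ξ‖ < min r 1 := by
    have : Continuous fun z => ‖z - ξ‖ + √‖z - ξ‖ := by fun_prop
    have := this.tendsto ξ
    rw [sub_self, norm_zero, Real.sqrt_zero, add_zero] at this
    exact this.eventually_lt_const (lt_min hr one_pos)
  filter_upwards [self_mem_nhdsWithin, nhdsWithin_le_nhds hpoly, nhdsWithin_le_nhds hnear]
    with z hzA hzp hzn
  have hzp := hzp hzA
  have hd := graphDist_pos_of_mem hα hzA
  have hdx := graphDist_le_re (ξ := ξ) (ψ := ψ) z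
  have hxz := (le_abs_self _).trans (abs_re_normalCoord_le (ξ := ξ) hν1 z)
  have hsn := Real.sqrt_nonneg ‖z - ξ‖
  set d := graphDist ξ ν ψ z with hddef
  have hs0 : 0 < √d := Real.sqrt_pos.2 hd
  have hsd : √d * √d = d := Real.mul_self_sqrt hd.le
  have hsz : √d ≤ √‖z - ξ‖ := Real.sqrt_le_sqrt (by linarith)
  have hd1 : d ≤ √d := by
    have : √d ≤ 1 := by linarith [min_le_right r 1, norm_nonneg (z - ξ)]
    nlinarith
  have hcoord : ∀ (j : Fin n) (s : ℂ),
      normalCoord ξ ν (z + s • b j) - normalCoord ξ ν z = s * inner ℂ (b i) (b j) := by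
    intro j s
    rw [normalCoord, normalCoord, ← inner_sub_right, ← hb,
      show z + s • b j - ξ - (z - ξ) = s • b j by abel, inner_smul_right]
  -- Cauchy estimate on a coordinate disc inside the polydisc. In the direction `b i` the radius is
  -- $cd$; for $j\ne i$ orthogonality leaves $z_1$ fixed, so $c\sqrt d$ is allowed.
  have hslice : ∀ (j : Fin n) (R : ℝ), 0 < R → R ≤ c * √d →
      (∀ s : ℂ, ‖s‖ ≤ R → ‖s * inner ℂ (b i) (b j)‖ ≤ c * d) →
      ‖fderiv ℂ f z (b j)‖ ≤ (1 + ‖f z‖ ^ 2) * (η / R) := by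
    intro j R hR hRc hRn
    have hmemA : ∀ s ∈ Metric.closedBall (0 : ℂ) R,
        z + s • b j ∈ Metric.ball ξ r ∩ approachRegion D ξ ν ψ β := by
      intro s hs
      rw [mem_closedBall_zero_iff] at hs
      have hn : ‖z + s • b j - z‖ = ‖s‖ := by
        rw [add_sub_cancel_left, norm_smul, b.norm_eq_one, mul_one]
      refine ⟨?_, hzp _ (by rw [hn]; exact hs.trans hRc) (by rw [hcoord]; exact hRn s hs)⟩
      rw [Metric.mem_ball, dist_eq_norm, ← sub_add_sub_cancel _ z ξ]
      refine (norm_add_le _ _).trans_lt ?_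
      rw [hn]
      have : c * √d ≤ √d := by nlinarith
      linarith [min_le_left r 1]
    have hline : ∀ s : ℂ, HasDerivAt (fun s : ℂ => z + s • b j) (b j) s := fun s => by
      simpa using ((hasDerivAt_id s).smul_const (b j)).const_add z
    have hfd : ∀ s ∈ Metric.closedBall (0 : ℂ) R,
        HasDerivAt (fun s : ℂ => f (z + s • b j)) (fderiv ℂ f (z + s • b j) (b j)) s := fun s hs =>
      (hf.differentiableAt (hD.mem_nhds (hmemA s hs).2.1)).hasFDerivAt.comp_hasDerivAt s (hline s)
    have key := hder (fun s : ℂ => f (z + s • b j)) 0 R hR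
      (fun s hs => (hfd s hs).differentiableAt) fun s hs => hrU (hmemA s hs)
    rw [(hfd 0 (Metric.mem_closedBall_self hR.le)).deriv, zero_smul, add_zero,
      inv_mul_le_iff₀ (by positivity)] at key
    exact key
  have hw : weightedGradient ξ ν ψ b i f z ≤ (1 + n) * ((1 + ‖f z‖ ^ 2) * (η / c)) := by
    refine weightedGradient_le hd ?_ fun j hj => ?_
    · have := hslice i (c * d) (by positivity) (by gcongr) fun s hs => by
        rw [norm_mul, inner_self_eq_norm_sq_to_K, b.norm_eq_one]
        simpa using hs
      calc _ ≤ d * ((1 + ‖f z‖ ^ 2) * (η / (c * d))) := by gcongr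
        _ = _ := by field_simp
    · have := hslice j (c * √d) (by positivity) le_rfl fun s _ => by
        rw [b.inner_eq_zero hj.symm, mul_zero, norm_zero]
        positivity
      calc _ ≤ √d * ((1 + ‖f z‖ ^ 2) * (η / (c * √d))) := by gcongr
        _ = _ := by field_simp
  rw [Real.dist_eq, sub_zero,
    abs_of_nonneg (mul_nonneg (by positivity) weightedGradient_nonneg)]
  calc _ ≤ (1 + ‖f z‖ ^ 2)⁻¹ * ((1 + n) * ((1 + ‖f z‖ ^ 2) * (η / c))) := by gcongr
    _ = ε / 2 := by
      rw [hη]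
      field_simp
    _ < ε := by linarith

end Necessity

theorem IsBoundaryGraphAt.hasAdmissibleLimit_iff {n : ℕ} {D : Set (EuclideanSpace ℂ (Fin n))}
    {ξ ν : EuclideanSpace ℂ (Fin n)} {ψ : realTangent ν → ℝ} (hψ : IsBoundaryGraphAt D ξ ν ψ)
    (hD : IsOpen D) (hξ : ξ ∈ frontier D) (hν : IsUnitOutwardNormal D ξ ν)
    {f : EuclideanSpace ℂ (Fin n) → ℂ} :
    HasAdmissibleLimit D f ξ ν ↔ ∃ L : OnePoint ℂ, ∀ α : ℝ, 0 < α →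
      Tendsto (fun z => (f z : OnePoint ℂ)) (𝓝[approachRegion D ξ ν ψ α] ξ) (𝓝 L) := by
  refine exists_congr fun L => ⟨fun h α hα => ?_, fun h α hα => ?_⟩
  · obtain ⟨β, hβ, hsub⟩ := hψ.exists_eventually_mem_admissibleDomain hD hξ hν hα
    exact (h β hβ).mono_left (nhdsWithin_le_iff.2 (by
      filter_upwards [self_mem_nhdsWithin, nhdsWithin_le_nhds hsub] with z h1 h2 using h2 h1))
  · refine (h (1 + α) (by positivity)).mono_left (nhdsWithin_le_iff.2 ?_)
    filter_upwards [self_mem_nhdsWithin,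
      nhdsWithin_le_nhds (hψ.eventually_mem_approachRegion hD hξ hν hα)] with z h1 h2 using h2 h1

theorem theorem2 {n : ℕ} (hn : 1 < n)
    (D : Set (EuclideanSpace ℂ (Fin n))) (hD_open : IsOpen D) (hD_conn : IsConnected D)
    (hD_bdry : HasC2Boundary D)
    (f : EuclideanSpace ℂ (Fin n) → ℂ) (hf : DifferentiableOn ℂ f D)
    (ξ : EuclideanSpace ℂ (Fin n)) (hξ : ξ ∈ frontier D)
    (ν : EuclideanSpace ℂ (Fin n)) (hν : IsUnitOutwardNormal D ξ ν)
    (ψ : realTangent ν → ℝ) (hψ : IsBoundaryGraphAt D ξ ν ψ)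
    (b : OrthonormalBasis (Fin n) ℂ (EuclideanSpace ℂ (Fin n)))
    (hb : b ⟨0, Nat.zero_lt_of_lt hn⟩ = -ν)
    (hlim : HasNormalLimit f ξ ν) :
    HasAdmissibleLimit D f ξ ν ↔
      ∀ α : ℝ, 0 < α →
        Tendsto
          (fun z => (1 + ‖f z‖ ^ 2)⁻¹ *
            weightedGradient ξ ν ψ b ⟨0, Nat.zero_lt_of_lt hn⟩ f z)
          (𝓝[approachRegion D ξ ν ψ α] ξ) (𝓝 0) := by
  rw [hψ.hasAdmissibleLimit_iff hD_open hξ hν]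
  constructor
  · rintro ⟨L, hL⟩ α hα
    exact hψ.tendsto_weightedGradient hD_open hξ hν hf hb hL hα
  · intro hG
    obtain ⟨L, hL⟩ := hlim
    exact ⟨L, fun α hα => hψ.tendsto_of_tendsto_weightedGradient hD_open hξ hν hf hb hL hα
      (hG (2 * α) (by positivity))⟩
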